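/- Let $Q$ and $M$ be (finite-dimensional, Hausdorff, boundaryless) smooth manifolds, $\pi : Q \to M$ a surjective submersion, $V\pi = \ker T\pi \subseteq TQ$ its vertical bundle, with projection $\tau : V\pi \to Q$, and $G\pi = \{(q,q') \in Q \times Q : \pi(q) = \pi(q')\}$; these are regular submanifolds of $TQ$ and $Q\times Q$. Let $\Gamma$ be a SODE on the Lie algebroid $V\pi$ (whose anchor is the inclusion $V\pi \subseteq TQ$), that is, a smooth vector field on $V\pi$ with $T_a\tau(\Gamma(a)) = a$ for all $a \in V\pi$; let $\Phi^\Gamma$ be its flow and, for $h>0$, let $D_h^\Gamma \subseteq V\pi$ be the set of those $v$ whose integral curve is defined at least on $[0,h]$. A trajectory of $\Gamma$ in a fibre $\pi^{-1}(m)$ is a curve $\sigma : [0,h] \to \pi^{-1}(m)$ whose tangent lift $\dot\sigma : [0,h] \to V\pi$ is an integral curve of $\Gamma$. Let $q_0 \in Q$. Then there are a compact neighbourhood $K$ of the zero vector $0_{q_0}$ in $V\pi$ and a number $h_0 > 0$ such that for every $h$ with $0 < h \le h_0$ the following holds. There is a unique trajectory $\sigma_{q_0q_0h} : [0,h] \to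 \pi^{-1}(\pi(q_0))$ of $\Gamma$ with $\sigma_{q_0q_0h}(0) = q_0 = \sigma_{q_0q_0h}(h)$ and $\dot\sigma_{q_0q_0h}(t) \in K$ for all $t \in [0,h]$. Moreover, with $v_{(h,q_0)} = \dot\sigma_{q_0q_0h}(0)$, there are an open subset $\mathcal U \subseteq V\pi$ with $v_{(h,q_0)} \in \mathcal U \subseteq D_h^\Gamma$ and an open subset $U \subseteq Q$ with $q_0 \in U$ such that: (i) the exponential map of $\Gamma$ at time $h$, $$\exp_h^\Gamma : \mathcal U \to (U \times U) \cap G\pi, \qquad v \mapsto \bigl(\tau(v), \tau(\Phi_h^\Gamma(v))\bigr),$$ is a diffeomorphism; (ii) for every $(q,q') \in (U\times U) \cap G\pi$ there is a unique trajectory $\sigma_{qq'h} : [0,h] \to \pi^{-1}(\pi(q))$ of $\Gamma$ with $\sigma_{qq'h}(0) = q$, $\sigma_{qq'h}(h) = q'$ and $\dot\sigma_{qq'h}(0) \in \mathcal U$. -/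

import Mathlib

open scoped Manifold ContDiff Topology

namespace FibredSODE

section Submanifolds

variable {E : Type*} [NormedAddCommGroup E] [NormedSpace ℝ E]
  {H : Type*} [TopologicalSpace H] (I : ModelWithCorners ℝ E H)
  {N : Type*} [TopologicalSpace N] [ChartedSpace H N]
  {E' : Type*} [NormedAddCommGroup E'] [NormedSpace ℝ E']
  {H' : Type*} [TopologicalSpace H'] (I' : ModelWithCorners ℝ E' H')
  {N' : Type*} [TopologicalSpace N'] [ChartedSpace H' N']

/-- The tangent vector `w` of the manifold `N` at `x` is tangent to the subset `S` of `N`: it is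
the velocity at time `0` of a smooth curve through `x` that stays in `S`. If `S` is a regular
submanifold this says that `w` belongs to the tangent space of `S` at `x`. -/
def IsTangentTo (S : Set N) (x : N) (w : TangentSpace I x) : Prop :=
  ∃ c : ℝ → N, c 0 = x ∧ ContMDiffAt 𝓘(ℝ, ℝ) I ∞ c 0 ∧ (∀ᶠ t in 𝓝 (0 : ℝ), c t ∈ S) ∧
    HasMFDerivAt 𝓘(ℝ, ℝ) I c (0 : ℝ) ((1 : ℝ →L[ℝ] ℝ).smulRight (w : E))

/-- `f` restricts to a diffeomorphism of the subset `S` of `N` onto the subset `S'` of `N'`: it is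
a bijection of `S` onto `S'`, smooth on `S`, and its inverse is smooth on `S'`.
For (relatively open subsets of) regular submanifolds, smoothness on the subset, as a map defined
on a subset of the ambient manifold, is the same as smoothness for the submanifold structure. -/
def IsDiffeoOn (f : N → N') (S : Set N) (S' : Set N') : Prop :=
  Set.BijOn f S S' ∧ ContMDiffOn I I' ∞ f S ∧
    ∃ g : N' → N, Set.InvOn g f S S' ∧ ContMDiffOn I' I ∞ g S'

end Submanifolds

section Fibration

variable {E : Type*} [NormedAddCommGroup E] [NormedSpace ℝ E]
  {B : Type*} [NormedAddCommGroup B] [NormedSpace ℝ B]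
  {Q : Type*} [TopologicalSpace Q] [ChartedSpace E Q] [IsManifold 𝓘(ℝ, E) ∞ Q]
  {M : Type*} [TopologicalSpace M] [ChartedSpace B M]

/-- The vertical bundle `Vπ = ker Tπ`, as a subset (a regular submanifold if `π` is a submersion)
of the tangent bundle `TQ`. Its projection to `Q` is the restriction of the one of `TQ`, and its
anchor is the inclusion in `TQ`. -/
def verticalBundle (π : Q → M) : Set (TangentBundle 𝓘(ℝ, E) Q) :=
  {v | mfderiv 𝓘(ℝ, E) 𝓘(ℝ, B) π v.proj v.2 = 0}

/-- The groupoid `Gπ = {(q₁, q₂) | π q₁ = π q₂}`, as a subset (a regular submanifold if `π` is a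
submersion) of `Q × Q`. -/
def fibrePairs (π : Q → M) : Set (Q × Q) :=
  {p | π p.1 = π p.2}

variable (Q) in
/-- Assignments of a tangent vector of `TQ` at `v` to every `v ∈ TQ`. Such an assignment `Γ` is
used to represent a vector field on `Vπ ⊆ TQ`, and only its values at the points of `Vπ` matter. -/
abbrev VelocityField : Type _ :=
  (v : TangentBundle 𝓘(ℝ, E) Q) → TangentSpace (𝓘(ℝ, E)).tangent v

/-- `Γ` is a smooth vector field on the manifold `Vπ` and is a SODE on the Lie algebroid `Vπ`:
`T_aτ (Γ a) = ρ a` for all `a ∈ Vπ`, where `τ` is the projection and the anchor `ρ` is the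
inclusion of `Vπ` in `TQ`. -/
structure IsSODE (π : Q → M) (Γ : VelocityField (E := E) Q) : Prop where
  smooth : ContMDiffOn (𝓘(ℝ, E)).tangent (𝓘(ℝ, E)).tangent.tangent ∞
    (fun v ↦ (⟨v, Γ v⟩ : TangentBundle (𝓘(ℝ, E)).tangent (TangentBundle 𝓘(ℝ, E) Q)))
    (verticalBundle (E := E) (B := B) π)
  tangent : ∀ a ∈ verticalBundle (E := E) (B := B) π,
    IsTangentTo (𝓘(ℝ, E)).tangent (verticalBundle (E := E) (B := B) π) a (Γ a)
  sode : ∀ a ∈ verticalBundle (E := E) (B := B) π,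
    mfderiv (𝓘(ℝ, E)).tangent 𝓘(ℝ, E)
      (fun v : TangentBundle 𝓘(ℝ, E) Q ↦ v.proj) a (Γ a) = a.2

/-- The restriction of `c` to `[0, h]` is an integral curve in `Vπ` of the vector field `Γ`. -/
def IsIntegralCurve (π : Q → M) (Γ : VelocityField (E := E) Q) (h : ℝ)
    (c : ℝ → TangentBundle 𝓘(ℝ, E) Q) : Prop :=
  (∀ t ∈ Set.Icc 0 h, c t ∈ verticalBundle (E := E) (B := B) π) ∧
    IsMIntegralCurveOn c Γ (Set.Icc 0 h)

/-- The set of those `v ∈ Vπ` whose integral curve is defined at least on `[0, h]`. -/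
def flowDomain (π : Q → M) (Γ : VelocityField (E := E) Q) (h : ℝ) :
    Set (TangentBundle 𝓘(ℝ, E) Q) :=
  {v | ∃ c, c 0 = v ∧ IsIntegralCurve (B := B) π Γ h c}

open Classical in
/-- The time `h` flow `Φ_h` of the vector field `Γ` on `Vπ`, for `h ≥ 0`: it sends `v` to the value
at time `h` of the integral curve that starts at `v`. (Outside of `flowDomain π Γ h` the value is
irrelevant.) -/
noncomputable def flow (π : Q → M) (Γ : VelocityField (E := E) Q) (h : ℝ)
    (v : TangentBundle 𝓘(ℝ, E) Q) : TangentBundle 𝓘(ℝ, E) Q :=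
  if hv : v ∈ flowDomain (B := B) π Γ h then hv.choose h else v

/-- The exponential map `v ↦ (τ v, τ (Φ_h v))` of `Γ` at time `h`. -/
noncomputable def expMap (π : Q → M) (Γ : VelocityField (E := E) Q) (h : ℝ)
    (v : TangentBundle 𝓘(ℝ, E) Q) : Q × Q :=
  (v.proj, (flow (B := B) π Γ h v).proj)

/-- The tangent lift `t ↦ (σ t, σ' t)` of the curve `σ` on `[0, h]` (with one-sided derivatives at
the ends). -/
noncomputable def tangentLift (h : ℝ) (σ : ℝ → Q) (t : ℝ) : TangentBundle 𝓘(ℝ, E) Q :=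
  ⟨σ t, mfderivWithin 𝓘(ℝ, ℝ) 𝓘(ℝ, E) σ (Set.Icc 0 h) t (1 : ℝ)⟩

/-- The restriction of `σ` to `[0, h]` is a curve in the fibre `π ⁻¹ {m}` and it is a trajectory of
the restriction of `Γ` to the tangent bundle of that fibre: its tangent lift is an integral curve
of `Γ`. -/
def IsFibreTrajectory (π : Q → M) (Γ : VelocityField (E := E) Q) (m : M) (h : ℝ)
    (σ : ℝ → Q) : Prop :=
  (∀ t ∈ Set.Icc 0 h, π (σ t) = m) ∧
    IsIntegralCurve (B := B) π Γ h (tangentLift (E := E) h σ)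

/-- `σ` is, up to its values outside of `[0, h]`, the unique curve on `[0, h]` with property `P`. -/
def IsUniqueOn (h : ℝ) (P : (ℝ → Q) → Prop) (σ : ℝ → Q) : Prop :=
  P σ ∧ ∀ σ', P σ' → Set.EqOn σ' σ (Set.Icc 0 h)

end Fibration

end FibredSODE

open FibredSODE

/-!
In a chart `(m, x)` of `Q` in which `π` is the projection to `m`, the vertical bundle has
coordinates `(m, x, v)`, and a trajectory of `Γ` is a solution of a second order equation
`x'' = f (m, x, x')` with constant parameter `m`. After multiplication by a bump function, `f` is
defined everywhere, smooth, bounded and Lipschitz. The theorem then says that for a short time `h`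
the two-point boundary value problem is well posed, with smooth dependence on the data.

Take the acceleration `w = x''`, an element of `C([0, h], F)`, as the unknown. Both the initial
value problem and the boundary value problem become fixed point equations `w = f ∘ S (B (p, w), w)`:
the linear operator `S` (`stateCurve`) integrates twice, and the linear map `B` gives the initial
state, which is the datum `p` itself in the first case, and in the second case the state whose
velocity is such that the curve ends at `x h` (`boundaryState`). The part of `S (B (p, w), w)` that
depends on `w` has norm at most `2 h ‖w‖`, so that the right-hand side is a contraction for small
`h`. Superposition with a smooth map is a smooth operation on continuous functions
(`contDiff_comp_left`), hence by the implicit function theorem the fixed point is a smooth function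
of `p` (`exists_contDiff_fixedPoint`). Consequently `(m, x 0, v 0) ↦ (m, x 0, x h)` is a
diffeomorphism of the whole coordinate space, its inverse being given by the boundary value problem
(`exists_boundary_diffeo`). No separate theory of the flow or inverse function theorem for the
exponential map is needed.

For equal end points the velocities of the solution are `O(h)`, so that for small `h` it remains in
the ball on which the cut-off does not change `f`. The same holds for nearby data, by continuity.
These solutions are the trajectories of the theorem. They compete only with integral curves in the
vertical bundle, which are determined by their initial value (`IsIntegralCurve.eqOn`). The
vector field `Γ` can be recovered from `f` because it is tangent to the vertical bundle
(`IsFibreChart.mfderiv_ofState`).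
-/

namespace FibredSODE

/-! ### Superposition operators -/

section Superposition

/-- The pointwise evaluation of a continuous family of operators on a continuous family of vectors,
as a continuous linear map `C(K, X →L Y) → (C(K, X) →L C(K, Y))`. -/
noncomputable def pointwiseApply (K X Y : Type*) [TopologicalSpace K] [CompactSpace K]
    [NormedAddCommGroup X] [NormedSpace ℝ X] [NormedAddCommGroup Y] [NormedSpace ℝ Y] :
    C(K, X →L[ℝ] Y) →L[ℝ] C(K, X) →L[ℝ] C(K, Y) :=
  LinearMap.mkContinuous₂
    (LinearMap.mk₂ ℝ
      (fun (A : C(K, X →L[ℝ] Y)) (u : C(K, X)) ↦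
        (⟨fun t ↦ A t (u t), A.continuous.clm_apply u.continuous⟩ : C(K, Y)))
      (fun A B u ↦ by ext t; rfl) (fun c A u ↦ by ext t; rfl)
      (fun A u v ↦ by ext t; exact map_add (A t) (u t) (v t))
      (fun c A u ↦ by ext t; exact map_smul (A t) c (u t)))
    1 (fun A u ↦ by
      rw [ContinuousMap.norm_le _ (by positivity)]
      intro t
      calc ‖A t (u t)‖ ≤ ‖A t‖ * ‖u t‖ := (A t).le_opNorm _
        _ ≤ 1 * ‖A‖ * ‖u‖ := by
          rw [one_mul]
          gcongr
          exacts [A.norm_coe_le_norm t, u.norm_coe_le_norm t])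

/-- The derivative of a superposition operator at `u` is pointwise multiplication by `f' ∘ u`. The
remainder is estimated by the mean value inequality on the segments `[u t, u t + k t]`, uniformly in
`t` because `u ↦ f' ∘ u` is continuous. -/
theorem hasFDerivAt_comp_left {K X Y : Type*} [TopologicalSpace K] [CompactSpace K]
    [NormedAddCommGroup X] [NormedSpace ℝ X] [NormedAddCommGroup Y] [NormedSpace ℝ Y]
    (f : C(X, Y)) (f' : C(X, X →L[ℝ] Y)) (hf : ∀ x, HasFDerivAt f (f' x) x) (u : C(K, X)) :
    HasFDerivAt (fun u : C(K, X) ↦ f.comp u) (pointwiseApply K X Y (f'.comp u)) u := by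
  rw [hasFDerivAt_iff_isLittleO_nhds_zero, Asymptotics.isLittleO_iff]
  intro ε hε
  have hcont : Continuous fun v : C(K, X) ↦ dist (f'.comp v) (f'.comp u) :=
    (f'.continuous_postcomp (X := K)).dist continuous_const
  have hc : ∀ᶠ v in 𝓝 u, dist (f'.comp v) (f'.comp u) < ε :=
    hcont.continuousAt.eventually_lt continuousAt_const (by simpa using hε)
  obtain ⟨δ, hδ, hδu⟩ := Metric.eventually_nhds_iff.1 hc
  filter_upwards [Metric.ball_mem_nhds (0 : C(K, X)) hδ] with k hk
  rw [mem_ball_zero_iff] at hk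
  rw [ContinuousMap.norm_le _ (by positivity)]
  intro t
  have hseg : ∀ y ∈ segment ℝ (u t) (u t + k t), ‖f' y - f' (u t)‖ ≤ ε := by
    intro y hy
    rw [segment_eq_image'] at hy
    obtain ⟨s, hs, rfl⟩ := hy
    have h1 : dist (u + s • k) u < δ := by
      rw [dist_eq_norm, add_sub_cancel_left, norm_smul, Real.norm_of_nonneg hs.1]
      exact lt_of_le_of_lt (mul_le_of_le_one_left (norm_nonneg _) hs.2) hk
    have h2 := (ContinuousMap.dist_apply_le_dist (f := f'.comp (u + s • k))
      (g := f'.comp u) t).trans (hδu h1).le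
    rw [dist_eq_norm] at h2
    simpa using h2
  have := (convex_segment (𝕜 := ℝ) (u t) (u t + k t)).norm_image_sub_le_of_norm_hasFDerivWithin_le'
    (fun y _ ↦ (hf y).hasFDerivWithinAt) hseg (left_mem_segment ℝ _ _) (right_mem_segment ℝ _ _)
  rw [add_sub_cancel_left] at this
  exact this.trans (by gcongr; exact k.norm_coe_le_norm t)

universe u v

/-- Auxiliary form of `contDiff_comp_left`: the induction replaces `Y` by `X →L Y`, which forces
both spaces into the same universe. -/
theorem contDiff_comp_left_aux {K : Type v} [TopologicalSpace K] [CompactSpace K]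
    {X : Type u} [NormedAddCommGroup X] [NormedSpace ℝ X] (n : ℕ) :
    ∀ {Y : Type u} [NormedAddCommGroup Y] [NormedSpace ℝ Y] (f : C(X, Y)), ContDiff ℝ ∞ f →
      ContDiff ℝ n (fun u : C(K, X) ↦ f.comp u) := by
  induction n with
  | zero =>
    intro Y _ _ f _
    exact contDiff_zero.2 (f.continuous_postcomp (X := K))
  | succ n ih =>
    intro Y _ _ f hf
    have hf' : ContDiff ℝ ∞ (fderiv ℝ f) := hf.fderiv_right (by simp)
    push_cast
    have h1 : ContDiff ℝ n fun u : C(K, X) ↦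
        pointwiseApply K X Y ((⟨fderiv ℝ f, hf'.continuous⟩ : C(X, X →L[ℝ] Y)).comp u) :=
      (ContinuousLinearMap.contDiff _).comp (ih ⟨fderiv ℝ f, hf'.continuous⟩ hf')
    refine contDiff_succ_iff_hasFDerivAt.2 ⟨_, h1, fun u ↦ ?_⟩
    exact hasFDerivAt_comp_left f ⟨fderiv ℝ f, hf'.continuous⟩
      (fun x ↦ (hf.differentiable (by simp) x).hasFDerivAt) u

/-- Superposition with a smooth map is a smooth operation on spaces of continuous functions. -/
theorem contDiff_comp_left {K X Y : Type*} [TopologicalSpace K] [CompactSpace K]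
    [NormedAddCommGroup X] [NormedSpace ℝ X] [NormedAddCommGroup Y] [NormedSpace ℝ Y]
    (f : C(X, Y)) (hf : ContDiff ℝ ∞ f) :
    ContDiff ℝ ∞ (fun u : C(K, X) ↦ f.comp u) := by
  let g : C(X × Y, X × Y) := ⟨fun z ↦ (0, f z.1), by fun_prop⟩
  have hg : ContDiff ℝ ∞ g := contDiff_const.prodMk (hf.comp contDiff_fst)
  have h1 : ContDiff ℝ ∞ (fun u : C(K, X × Y) ↦ g.comp u) :=
    contDiff_infty.2 fun n ↦ contDiff_comp_left_aux n g hg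
  exact (((ContinuousLinearMap.snd ℝ X Y).compLeftContinuous ℝ K).contDiff.comp h1).comp
    ((ContinuousLinearMap.inl ℝ X Y).compLeftContinuous ℝ K).contDiff

end Superposition

/-! ### Fixed points depending on a parameter -/

section ParametrizedContraction

/-- A family of contractions that depends smoothly on a parameter has a fixed point that depends
smoothly on the parameter. -/
theorem exists_contDiff_fixedPoint {D Y : Type*} [NormedAddCommGroup D] [NormedSpace ℝ D]
    [CompleteSpace D] [NormedAddCommGroup Y] [NormedSpace ℝ Y] [CompleteSpace Y]
    (T : D × Y → Y) (hT : ContDiff ℝ ∞ T) {k : NNReal} (hk : k < 1)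
    (hTk : ∀ p, LipschitzWith k fun y ↦ T (p, y)) :
    ∃ W : D → Y, ContDiff ℝ ∞ W ∧ ∀ p y, T (p, y) = y ↔ y = W p := by
  have hc : ∀ p, ContractingWith k fun y ↦ T (p, y) := fun p ↦ ⟨hk, hTk p⟩
  let W : D → Y := fun p ↦ ContractingWith.fixedPoint _ (hc p)
  have hW : ∀ p y, T (p, y) = y ↔ y = W p := fun p y ↦
    ⟨fun h ↦ (hc p).fixedPoint_unique h, fun h ↦ by rw [h]; exact (hc p).fixedPoint_isFixedPt⟩
  have hWc : Continuous W := by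
    rw [continuous_iff_continuousAt]
    intro p₀
    have h1 : ∀ p, dist (W p) (W p₀) ≤ dist (W p₀) (T (p, W p₀)) / (1 - k) := fun p ↦ by
      rw [dist_comm]
      exact (hc p).dist_fixedPoint_le (W p₀)
    have h2 : Filter.Tendsto (fun p ↦ dist (W p₀) (T (p, W p₀)) / (1 - k)) (𝓝 p₀) (𝓝 0) := by
      have : Continuous fun p ↦ dist (W p₀) (T (p, W p₀)) / (1 - k : ℝ) := by
        have := hT.continuous
        fun_prop
      have h3 := this.tendsto p₀
      rwa [(hW p₀ (W p₀)).2 rfl, dist_self, zero_div] at h3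
    exact tendsto_iff_dist_tendsto_zero.2
      (squeeze_zero (fun _ ↦ dist_nonneg) h1 h2)
  refine ⟨W, contDiff_iff_contDiffAt.2 fun p₀ ↦ ?_, hW⟩
  let f : D × Y → Y := fun z ↦ z.2 - T z
  have hf : ContDiffAt ℝ ∞ f (p₀, W p₀) := (contDiff_snd.sub hT).contDiffAt
  have hd : DifferentiableAt ℝ T (p₀, W p₀) := hT.differentiable (by simp) _
  have hinv : (fderiv ℝ f (p₀, W p₀) ∘L .inr ℝ D Y).IsInvertible := by
    have e : fderiv ℝ f (p₀, W p₀) ∘L .inr ℝ D Y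
        = 1 - fderiv ℝ T (p₀, W p₀) ∘L .inr ℝ D Y := by
      have : fderiv ℝ f (p₀, W p₀) = .snd ℝ D Y - fderiv ℝ T (p₀, W p₀) :=
        (hasFDerivAt_snd.sub hd.hasFDerivAt).fderiv
      rw [this]
      ext y
      simp
    have hn : ‖fderiv ℝ T (p₀, W p₀) ∘L .inr ℝ D Y‖ < 1 := by
      have h1 : HasFDerivAt (fun y ↦ T (p₀, y)) (fderiv ℝ T (p₀, W p₀) ∘L .inr ℝ D Y) (W p₀) :=
        hd.hasFDerivAt.comp (W p₀) (hasFDerivAt_prodMk_right p₀ (W p₀))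
      exact (h1.le_of_lipschitz (hTk p₀)).trans_lt hk
    rw [e]
    obtain ⟨v, hv⟩ := isUnit_one_sub_of_norm_lt_one hn
    exact ⟨ContinuousLinearEquiv.ofUnit v, by rw [← hv]; rfl⟩
  refine (hf.contDiffAt_implicitFunction (by simp) hinv).congr_of_eventuallyEq ?_
  have h1 := hf.eventually_apply_eq_iff_implicitFunction (by simp) hinv
  have h2 : Filter.Tendsto (fun p ↦ (p, W p)) (𝓝 p₀) (𝓝 (p₀, W p₀)) :=
    (continuous_id.prodMk hWc).tendsto p₀
  filter_upwards [h2.eventually h1] with p hp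
  refine (hp.1 ?_).symm
  simp only [f, (hW _ _).2 rfl, sub_self]

end ParametrizedContraction

/-! ### Integration of continuous curves -/

section Integration

variable {F : Type*} [NormedAddCommGroup F] [NormedSpace ℝ F]

/-- The primitive that vanishes at `0`, as a continuous linear operator on `C([0, h], F)`. -/
noncomputable def primitive (F : Type*) [NormedAddCommGroup F] [NormedSpace ℝ F]
    {h : ℝ} (hh : 0 ≤ h) : C(Set.Icc 0 h, F) →L[ℝ] C(Set.Icc 0 h, F) :=
  LinearMap.mkContinuous
    { toFun := fun w ↦ ⟨fun t ↦ ∫ s in (0 : ℝ)..t, Set.IccExtend hh w s,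
        (intervalIntegral.continuous_primitive
          (fun a b ↦ w.continuous.Icc_extend'.intervalIntegrable a b) 0).comp
          continuous_subtype_val⟩
      map_add' := fun w w' ↦ by
        ext t
        exact intervalIntegral.integral_add (w.continuous.Icc_extend'.intervalIntegrable _ _)
          (w'.continuous.Icc_extend'.intervalIntegrable _ _)
      map_smul' := fun c w ↦ by
        ext t
        exact intervalIntegral.integral_smul c _ }
    h (fun w ↦ by
      rw [ContinuousMap.norm_le _ (by positivity)]
      intro t
      have h1 : ‖∫ s in (0 : ℝ)..t, Set.IccExtend hh w s‖ ≤ ‖w‖ * |(t : ℝ) - 0| :=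
        intervalIntegral.norm_integral_le_of_norm_le_const fun s _ ↦ w.norm_coe_le_norm _
      rw [sub_zero, abs_of_nonneg t.2.1, mul_comm] at h1
      exact h1.trans (by gcongr; exact t.2.2))

variable {h : ℝ} (hh : 0 ≤ h)

theorem norm_primitive_apply_le (w : C(Set.Icc 0 h, F)) : ‖primitive F hh w‖ ≤ h * ‖w‖ :=
  (primitive F hh).le_of_opNorm_le (LinearMap.mkContinuous_norm_le _ hh _) w

theorem primitive_apply (w : C(Set.Icc 0 h, F)) (t : Set.Icc 0 h) :
    primitive F hh w t = ∫ s in (0 : ℝ)..t, Set.IccExtend hh w s := rfl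

@[simp]
theorem primitive_left (w : C(Set.Icc 0 h, F)) : primitive F hh w ⟨0, le_rfl, hh⟩ = 0 := by
  simp [primitive_apply]

theorem hasDerivWithinAt_primitive [CompleteSpace F] (w : C(Set.Icc 0 h, F)) (t : Set.Icc 0 h) :
    HasDerivWithinAt (Set.IccExtend hh (primitive F hh w)) (w t) (Set.Icc 0 h) t := by
  have h1 : HasDerivAt (fun t ↦ ∫ s in (0 : ℝ)..t, Set.IccExtend hh w s)
      (Set.IccExtend hh w t) t :=
    intervalIntegral.integral_hasDerivAt_right
      (w.continuous.Icc_extend'.intervalIntegrable _ _)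
      (w.continuous.Icc_extend'.stronglyMeasurableAtFilter _ _)
      w.continuous.Icc_extend'.continuousAt
  rw [Set.IccExtend_val] at h1
  refine h1.hasDerivWithinAt.congr (fun s hs ↦ ?_) ?_
  · rw [Set.IccExtend_of_mem hh _ hs, primitive_apply]
  · rw [Set.IccExtend_val, primitive_apply]

/-- The fundamental theorem of calculus, for a curve on `[0, h]` with continuous derivative. -/
theorem eq_add_primitive [CompleteSpace F] (hlt : 0 < h) {x : ℝ → F} (w : C(Set.Icc 0 h, F))
    (hx : ∀ t : Set.Icc 0 h, HasDerivWithinAt x (w t) (Set.Icc 0 h) t) (t : Set.Icc 0 h) :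
    x t = x 0 + primitive F hlt.le w t := by
  have h1 : ∀ t : Set.Icc 0 h, HasDerivWithinAt
      (x - Set.IccExtend hlt.le (primitive F hlt.le w)) 0 (Set.Icc 0 h) t := fun t ↦ by
    simpa using (hx t).sub (hasDerivWithinAt_primitive hlt.le w t)
  have h2 := (convex_Icc (0 : ℝ) h).is_const_of_fderivWithin_eq_zero (𝕜 := ℝ)
    (f := x - Set.IccExtend hlt.le (primitive F hlt.le w))
    (fun t ht ↦ (h1 ⟨t, ht⟩).differentiableWithinAt) (fun t ht ↦ by
      have := (h1 ⟨t, ht⟩).hasFDerivWithinAt.fderivWithin (uniqueDiffOn_Icc hlt t ht)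
      simpa using this) t.2 (Set.left_mem_Icc.2 hlt.le)
  simp only [Pi.sub_apply, Set.IccExtend_val] at h2
  rw [Set.IccExtend_of_mem hlt.le _ (Set.left_mem_Icc.2 hlt.le), primitive_left, sub_zero] at h2
  rw [← h2, sub_add_cancel]

end Integration

/-! ### Second order equations on a short interval -/

section SecondOrder

variable {P F : Type*} [NormedAddCommGroup P] [NormedSpace ℝ P]
  [NormedAddCommGroup F] [NormedSpace ℝ F]

/-- The curve `z = (m, x, v)` solves on `[0, h]` the second order equation `x'' = f (m, x, x')`
with constant parameter `m`, written as a first order system. -/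
def IsSolutionOn (f : P × F × F → F) (h : ℝ) (z : ℝ → P × F × F) : Prop :=
  ∀ t ∈ Set.Icc 0 h, HasDerivWithinAt z (0, (z t).2.2, f (z t)) (Set.Icc 0 h) t

variable {h : ℝ} (hh : 0 ≤ h)

/-- The velocity on `[0, h]` of a curve with initial state `(m, x, v)` and acceleration `w`. -/
noncomputable def velocityCurve : (P × F × F) × C(Set.Icc 0 h, F) →L[ℝ] C(Set.Icc 0 h, F) :=
  ((ContinuousLinearMap.const ℝ (Set.Icc 0 h)) ∘L .snd ℝ F F ∘L .snd ℝ P (F × F)).coprod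
    (primitive F hh)

/-- The position on `[0, h]` of a curve with initial state `(m, x, v)` and acceleration `w`. -/
noncomputable def positionCurve : (P × F × F) × C(Set.Icc 0 h, F) →L[ℝ] C(Set.Icc 0 h, F) :=
  (ContinuousLinearMap.const ℝ (Set.Icc 0 h)) ∘L .fst ℝ F F ∘L .snd ℝ P (F × F) ∘L
      .fst ℝ (P × F × F) C(Set.Icc 0 h, F) + primitive F hh ∘L velocityCurve hh

/-- The curve of states `(m, x t, v t)` on `[0, h]` that is determined by an initial state and by
its acceleration. -/
noncomputable def stateCurve :
    (P × F × F) × C(Set.Icc 0 h, F) →L[ℝ] C(Set.Icc 0 h, P × F × F) :=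
  (ContinuousLinearMap.inl ℝ P (F × F)).compLeftContinuous ℝ (Set.Icc 0 h) ∘L
      (ContinuousLinearMap.const ℝ (Set.Icc 0 h)) ∘L .fst ℝ P (F × F) ∘L
      .fst ℝ (P × F × F) C(Set.Icc 0 h, F) +
    (ContinuousLinearMap.inr ℝ P (F × F) ∘L .inl ℝ F F).compLeftContinuous ℝ (Set.Icc 0 h) ∘L
      positionCurve hh +
    (ContinuousLinearMap.inr ℝ P (F × F) ∘L .inr ℝ F F).compLeftContinuous ℝ (Set.Icc 0 h) ∘L
      velocityCurve hh

/-- `velocityCurve` is `v t = v₀ + ∫₀ᵗ w`. -/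
theorem velocityCurve_apply (z₀ : P × F × F) (w : C(Set.Icc 0 h, F)) (t : Set.Icc 0 h) :
    velocityCurve hh (z₀, w) t = z₀.2.2 + primitive F hh w t := rfl

/-- `positionCurve` is `x t = x₀ + ∫₀ᵗ v`. -/
theorem positionCurve_apply (z₀ : P × F × F) (w : C(Set.Icc 0 h, F)) (t : Set.Icc 0 h) :
    positionCurve hh (z₀, w) t = z₀.2.1 + primitive F hh (velocityCurve hh (z₀, w)) t := rfl

theorem stateCurve_apply (z₀ : P × F × F) (w : C(Set.Icc 0 h, F)) (t : Set.Icc 0 h) :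
    stateCurve hh (z₀, w) t =
      (z₀.1, positionCurve hh (z₀, w) t, velocityCurve hh (z₀, w) t) := by
  change ((z₀.1, 0, 0) + (0, positionCurve hh (z₀, w) t, 0) +
    (0, 0, velocityCurve hh (z₀, w) t) : P × F × F) = _
  simp

theorem stateCurve_left (z₀ : P × F × F) (w : C(Set.Icc 0 h, F)) :
    stateCurve hh (z₀, w) ⟨0, le_rfl, hh⟩ = z₀ := by
  simp [stateCurve_apply, positionCurve_apply, velocityCurve_apply]

theorem norm_velocityCurve_le (z₀ : P × F × F) (w : C(Set.Icc 0 h, F)) :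
    ‖velocityCurve hh (z₀, w)‖ ≤ ‖z₀.2.2‖ + h * ‖w‖ := by
  rw [ContinuousMap.norm_le _ (by positivity)]
  intro t
  rw [velocityCurve_apply]
  refine (norm_add_le _ _).trans ?_
  gcongr
  exact (ContinuousMap.norm_coe_le_norm _ t).trans (norm_primitive_apply_le hh w)

/-- A bound for the part of the state curve that is due to the velocity and the acceleration. -/
theorem norm_stateCurve_le (h1 : h ≤ 1) (v : F) (w : C(Set.Icc 0 h, F)) :
    ‖stateCurve hh (((0, 0, v) : P × F × F), w)‖ ≤ ‖v‖ + h * ‖w‖ := by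
  have hv := norm_velocityCurve_le hh ((0, 0, v) : P × F × F) w
  rw [ContinuousMap.norm_le _ (by positivity)]
  intro t
  rw [stateCurve_apply, positionCurve_apply, zero_add]
  refine norm_prod_le_iff.2 ⟨by simp; positivity, norm_prod_le_iff.2 ⟨?_, ?_⟩⟩
  · refine (ContinuousMap.norm_coe_le_norm _ t).trans ((norm_primitive_apply_le hh _).trans ?_)
    exact (mul_le_of_le_one_left (norm_nonneg _) h1).trans hv
  · exact (ContinuousMap.norm_coe_le_norm _ t).trans hv

/-- The state curve minus the constant curve at rest depends only on the velocity and the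
acceleration. -/
theorem stateCurve_sub (z₀ : P × F × F) (w : C(Set.Icc 0 h, F)) (t : Set.Icc 0 h) :
    stateCurve hh (z₀, w) t - (z₀.1, z₀.2.1, 0) =
      stateCurve hh (((0, 0, z₀.2.2) : P × F × F), w) t := by
  have e : velocityCurve hh (z₀, w) = velocityCurve hh (((0, 0, z₀.2.2) : P × F × F), w) :=
    ContinuousMap.ext fun t ↦ by rw [velocityCurve_apply, velocityCurve_apply]
  simp only [stateCurve_apply, positionCurve_apply, e]
  simp

/-- The initial state of the curve with parameter `m` that goes from `x₀` to `x₁` in time `h` with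
a given acceleration `w`: integrating `w` twice, `x₁ = x₀ + h v₀ + ∫∫ w`, which gives `v₀`. -/
noncomputable def boundaryState :
    (P × F × F) × C(Set.Icc 0 h, F) →L[ℝ] P × F × F :=
  (.fst ℝ P (F × F) ∘L .fst ℝ _ _ : (P × F × F) × C(Set.Icc 0 h, F) →L[ℝ] P).prod
    ((.fst ℝ F F ∘L .snd ℝ P (F × F) ∘L .fst ℝ _ _ : (P × F × F) × C(Set.Icc 0 h, F) →L[ℝ] F).prod
      (h⁻¹ • ((.snd ℝ F F - .fst ℝ F F) ∘L .snd ℝ P (F × F) ∘L .fst ℝ _ _ -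
        ContinuousMap.evalCLM ℝ (⟨h, hh, le_rfl⟩ : Set.Icc 0 h) ∘L primitive F hh ∘L
          primitive F hh ∘L .snd ℝ _ _)))

theorem boundaryState_apply (p : P × F × F) (w : C(Set.Icc 0 h, F)) :
    boundaryState hh (p, w) = (p.1, p.2.1, h⁻¹ • ((p.2.2 - p.2.1) -
      primitive F hh (primitive F hh w) ⟨h, hh, le_rfl⟩)) := rfl

theorem norm_boundaryState_le (hlt : 0 < h) (m : P) (x : F) (w : C(Set.Icc 0 h, F)) :
    ‖(boundaryState hh ((m, x, x), w)).2.2‖ ≤ h * ‖w‖ := by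
  simp only [boundaryState_apply, sub_self, zero_sub, norm_smul, norm_neg, norm_inv,
    Real.norm_of_nonneg hh]
  rw [inv_mul_le_iff₀ hlt]
  refine (ContinuousMap.norm_coe_le_norm _ _).trans ((norm_primitive_apply_le hh _).trans ?_)
  gcongr
  exact norm_primitive_apply_le hh w

theorem primitive_const [CompleteSpace F] (v : F) (t : Set.Icc 0 h) :
    primitive F hh (ContinuousMap.const _ v) t = (t : ℝ) • v := by
  rw [primitive_apply]
  change ∫ s in (0 : ℝ)..t, v = _
  simp

theorem stateCurve_right [CompleteSpace F] (z₀ : P × F × F) (w : C(Set.Icc 0 h, F)) :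
    (stateCurve hh (z₀, w) ⟨h, hh, le_rfl⟩).2.1 = z₀.2.1 + h • z₀.2.2 +
      primitive F hh (primitive F hh w) ⟨h, hh, le_rfl⟩ := by
  have e : velocityCurve hh (z₀, w) = ContinuousMap.const _ z₀.2.2 + primitive F hh w := rfl
  rw [stateCurve_apply, positionCurve_apply, e, map_add, ContinuousMap.add_apply, primitive_const,
    add_assoc]

variable [CompleteSpace F]

/-- A fixed point `w` of `w ↦ f ∘ stateCurve (z₀, w)` is the acceleration of a solution. -/
theorem isSolutionOn_stateCurve (f : C(P × F × F, F)) (z₀ : P × F × F) (w : C(Set.Icc 0 h, F))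
    (hw : f.comp (stateCurve hh (z₀, w)) = w) :
    IsSolutionOn f h (Set.IccExtend hh (stateCurve hh (z₀, w))) := by
  intro t ht
  rw [Set.IccExtend_of_mem hh _ ht]
  have hx := (hasDerivWithinAt_primitive hh (velocityCurve hh (z₀, w)) ⟨t, ht⟩).const_add z₀.2.1
  have hv := (hasDerivWithinAt_primitive hh w ⟨t, ht⟩).const_add z₀.2.2
  have hz : HasDerivWithinAt
      (fun s ↦ (z₀.1, z₀.2.1 + Set.IccExtend hh (primitive F hh (velocityCurve hh (z₀, w))) s,
        z₀.2.2 + Set.IccExtend hh (primitive F hh w) s))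
      (0, velocityCurve hh (z₀, w) ⟨t, ht⟩, w ⟨t, ht⟩) (Set.Icc 0 h) t :=
    (hasDerivWithinAt_const t (Set.Icc 0 h) z₀.1).prodMk (hx.prodMk hv)
  have e : f (stateCurve hh (z₀, w) ⟨t, ht⟩) = w ⟨t, ht⟩ := by
    conv_rhs => rw [← hw]
    rfl
  have e' : (stateCurve hh (z₀, w) ⟨t, ht⟩).2.2 = velocityCurve hh (z₀, w) ⟨t, ht⟩ := by
    rw [stateCurve_apply]
  have hcongr : ∀ s ∈ Set.Icc 0 h, Set.IccExtend hh (stateCurve hh (z₀, w)) s =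
      (z₀.1, z₀.2.1 + Set.IccExtend hh (primitive F hh (velocityCurve hh (z₀, w))) s,
        z₀.2.2 + Set.IccExtend hh (primitive F hh w) s) := fun s hs ↦ by
    rw [Set.IccExtend_of_mem hh _ hs, Set.IccExtend_of_mem hh _ hs, Set.IccExtend_of_mem hh _ hs,
      stateCurve_apply, positionCurve_apply, velocityCurve_apply]
  rw [e, e']
  exact hz.congr hcongr (hcongr t ht)

/-- The acceleration of a solution `z` is a fixed point of `w ↦ f ∘ stateCurve (z 0, w)`, and it
determines the solution. -/
theorem IsSolutionOn.exists_eq_stateCurve {f : C(P × F × F, F)} (hlt : 0 < h)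
    [CompleteSpace P] {z : ℝ → P × F × F} (hz : IsSolutionOn f h z) :
    ∃ w : C(Set.Icc 0 h, F), f.comp (stateCurve hlt.le (z 0, w)) = w ∧
      ∀ t : Set.Icc 0 h, z t = stateCurve hlt.le (z 0, w) t := by
  have hc : ContinuousOn z (Set.Icc 0 h) := fun t ht ↦ (hz t ht).continuousWithinAt
  have hc' := hc.domRestrict
  let w : C(Set.Icc 0 h, F) := ⟨fun t ↦ f (z t), f.continuous.comp hc'⟩
  have hm : ∀ t : Set.Icc 0 h, (z t).1 = (z 0).1 := fun t ↦ by
    have := eq_add_primitive hlt (x := fun t ↦ (z t).1) 0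
      (fun t ↦ (hz t t.2).fst) t
    simpa using this
  have hv : ∀ t : Set.Icc 0 h, (z t).2.2 = velocityCurve hlt.le (z 0, w) t := fun t ↦
    eq_add_primitive hlt (x := fun t ↦ (z t).2.2) w (fun t ↦ (hz t t.2).snd.snd) t
  have hx : ∀ t : Set.Icc 0 h, (z t).2.1 = positionCurve hlt.le (z 0, w) t := fun t ↦
    eq_add_primitive hlt (x := fun t ↦ (z t).2.1) (velocityCurve hlt.le (z 0, w))
      (fun t ↦ by rw [← hv]; exact (hz t t.2).snd.fst) t
  have hs : ∀ t : Set.Icc 0 h, z t = stateCurve hlt.le (z 0, w) t := fun t ↦ by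
    rw [stateCurve_apply, ← hm t, ← hv, ← hx]
  refine ⟨w, ?_, hs⟩
  ext t
  exact congrArg f (hs t).symm

theorem IsSolutionOn.fst_eq {f : C(P × F × F, F)} [CompleteSpace P] (hlt : 0 < h)
    {z : ℝ → P × F × F} (hz : IsSolutionOn f h z) {t : ℝ} (ht : t ∈ Set.Icc 0 h) :
    (z t).1 = (z 0).1 := by
  obtain ⟨w, -, hw⟩ := hz.exists_eq_stateCurve hlt
  rw [hw ⟨t, ht⟩, stateCurve_apply]

/-- For a short time, the accelerations of the solutions of `x'' = f (m, x, x')` whose initial state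
is a linear function `B` of a parameter and of the acceleration itself form a smooth family. The
initial value problem and the boundary value problem are both of this form. Only the initial
velocity may depend on the acceleration, by at most `h ‖w‖`. -/
theorem exists_contDiff_acceleration {D : Type*} [NormedAddCommGroup D] [NormedSpace ℝ D]
    [CompleteSpace D] (f : C(P × F × F, F)) (hf : ContDiff ℝ ∞ f) {L : NNReal}
    (hL : LipschitzWith L f) (h1 : h ≤ 1) (hLh : 2 * L * h < 1)
    (B : D × C(Set.Icc 0 h, F) →L[ℝ] P × F × F)
    (hB1 : ∀ w, (B (0, w)).1 = 0) (hB2 : ∀ w, (B (0, w)).2.1 = 0)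
    (hB3 : ∀ w, ‖(B (0, w)).2.2‖ ≤ h * ‖w‖) :
    ∃ W : D → C(Set.Icc 0 h, F), ContDiff ℝ ∞ W ∧
      ∀ p w, f.comp (stateCurve hh (B (p, w), w)) = w ↔ w = W p := by
  let S : D × C(Set.Icc 0 h, F) →L[ℝ] C(Set.Icc 0 h, P × F × F) :=
    stateCurve hh ∘L B.prod (.snd ℝ D C(Set.Icc 0 h, F))
  have hS : ∀ w, ‖S (0, w)‖ ≤ 2 * h * ‖w‖ := fun w ↦ by
    have e : B (0, w) = (0, 0, (B (0, w)).2.2) :=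
      Prod.ext (hB1 w) (Prod.ext (hB2 w) rfl)
    change ‖stateCurve hh (B (0, w), w)‖ ≤ _
    rw [e]
    linarith [norm_stateCurve_le (P := P) hh h1 (B (0, w)).2.2 w, hB3 w]
  have hk : 2 * L * h.toNNReal < 1 := by
    rw [← NNReal.coe_lt_coe, NNReal.coe_mul, NNReal.coe_mul, Real.coe_toNNReal h hh]
    exact hLh
  refine exists_contDiff_fixedPoint (fun y : D × C(Set.Icc 0 h, F) ↦ f.comp (S y))
    ((contDiff_comp_left f hf).comp S.contDiff) hk fun p ↦
    LipschitzWith.of_dist_le_mul fun w w' ↦ ?_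
  have e : S (p, w) - S (p, w') = S (0, w - w') := by
    rw [← map_sub, Prod.mk_sub_mk, sub_self]
  rw [ContinuousMap.dist_le (by positivity)]
  intro t
  calc dist (f (S (p, w) t)) (f (S (p, w') t)) ≤ L * dist (S (p, w) t) (S (p, w') t) :=
        hL.dist_le_mul _ _
    _ ≤ L * dist (S (p, w)) (S (p, w')) := by
        gcongr
        exact ContinuousMap.dist_apply_le_dist t
    _ ≤ L * (2 * h * ‖w - w'‖) := by
        rw [dist_eq_norm, e]
        gcongr
        exact hS _
    _ = ↑(2 * L * h.toNNReal) * dist w w' := by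
        rw [dist_eq_norm, NNReal.coe_mul, NNReal.coe_mul, Real.coe_toNNReal h hh, NNReal.coe_ofNat]
        ring

/-- Existence, uniqueness and smooth dependence on the initial state for the initial value
problem. -/
theorem exists_contDiff_initialValue [CompleteSpace P] (f : C(P × F × F, F)) (hf : ContDiff ℝ ∞ f)
    {L : NNReal} (hL : LipschitzWith L f) (hlt : 0 < h) (h1 : h ≤ 1) (hLh : 2 * L * h < 1) :
    ∃ Φ : P × F × F → C(Set.Icc 0 h, P × F × F), ContDiff ℝ ∞ Φ ∧
      (∀ z₀, IsSolutionOn f h (Set.IccExtend hlt.le (Φ z₀)) ∧ Φ z₀ ⟨0, le_rfl, hlt.le⟩ = z₀) ∧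
      ∀ z, IsSolutionOn f h z → ∀ t : Set.Icc 0 h, z t = Φ (z 0) t := by
  obtain ⟨W, hW, hfix⟩ := exists_contDiff_acceleration hlt.le f hf hL h1 hLh
    (.fst ℝ (P × F × F) C(Set.Icc 0 h, F)) (fun w ↦ rfl) (fun w ↦ rfl)
    (fun w ↦ by simp; positivity)
  have hΦ : ContDiff ℝ ∞ fun z₀ ↦ stateCurve hlt.le (z₀, W z₀) :=
    (ContinuousLinearMap.contDiff _).comp (contDiff_id.prodMk hW)
  refine ⟨fun z₀ ↦ stateCurve hlt.le (z₀, W z₀), hΦ, fun z₀ ↦ ⟨?_, stateCurve_left _ _ _⟩,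
    fun z hz t ↦ ?_⟩
  · exact isSolutionOn_stateCurve hlt.le f z₀ _ ((hfix z₀ _).2 rfl)
  · obtain ⟨w, hw, hzw⟩ := hz.exists_eq_stateCurve hlt
    rw [hzw t, (hfix (z 0) w).1 hw]

/-- Existence, uniqueness and smooth dependence on the end points for the boundary value problem,
and an estimate that keeps the solutions with equal end points near the state of rest. -/
theorem exists_contDiff_boundaryValue [CompleteSpace P] (f : C(P × F × F, F)) (hf : ContDiff ℝ ∞ f)
    {L : NNReal} (hL : LipschitzWith L f) {C : ℝ} (hC : ∀ z, ‖f z‖ ≤ C)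
    (hlt : 0 < h) (h1 : h ≤ 1) (hLh : 2 * L * h < 1) :
    ∃ Ψ : P × F × F → C(Set.Icc 0 h, P × F × F), ContDiff ℝ ∞ Ψ ∧
      (∀ p, IsSolutionOn f h (Set.IccExtend hlt.le (Ψ p)) ∧
        (Ψ p ⟨0, le_rfl, hlt.le⟩).1 = p.1 ∧ (Ψ p ⟨0, le_rfl, hlt.le⟩).2.1 = p.2.1 ∧
        (Ψ p ⟨h, hlt.le, le_rfl⟩).2.1 = p.2.2) ∧
      (∀ z, IsSolutionOn f h z →
        ∀ t : Set.Icc 0 h, z t = Ψ ((z 0).1, (z 0).2.1, (z h).2.1) t) ∧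
      ∀ m x t, ‖Ψ (m, x, x) t - (m, x, 0)‖ ≤ 2 * h * C := by
  obtain ⟨W, hW, hfix⟩ := exists_contDiff_acceleration hlt.le f hf hL h1 hLh
    (boundaryState (P := P) hlt.le) (fun w ↦ rfl) (fun w ↦ rfl)
    (fun w ↦ norm_boundaryState_le hlt.le hlt 0 0 w)
  have hb : ContDiff ℝ ∞ fun p ↦ boundaryState hlt.le (p, W p) :=
    (ContinuousLinearMap.contDiff _).comp (contDiff_id.prodMk hW)
  have hΨ : ContDiff ℝ ∞ fun p ↦ stateCurve hlt.le (boundaryState hlt.le (p, W p), W p) :=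
    (ContinuousLinearMap.contDiff _).comp (hb.prodMk hW)
  refine ⟨fun p ↦ stateCurve hlt.le (boundaryState hlt.le (p, W p), W p), hΨ,
    fun p ↦ ⟨isSolutionOn_stateCurve hlt.le f _ _ ((hfix p _).2 rfl), ?_, ?_, ?_⟩,
    fun z hz t ↦ ?_, fun m x t ↦ ?_⟩
  · rw [stateCurve_left, boundaryState_apply]
  · rw [stateCurve_left, boundaryState_apply]
  · rw [stateCurve_right, boundaryState_apply]
    simp only [smul_inv_smul₀ hlt.ne']
    abel
  · obtain ⟨w, hw, hzw⟩ := hz.exists_eq_stateCurve hlt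
    have hb : boundaryState hlt.le (((z 0).1, (z 0).2.1, (z h).2.1), w) = z 0 := by
      have := stateCurve_right hlt.le (z 0) w
      rw [← hzw ⟨h, hlt.le, le_rfl⟩] at this
      rw [boundaryState_apply]
      refine Prod.ext rfl (Prod.ext rfl ?_)
      simp only
      rw [inv_smul_eq_iff₀ hlt.ne', this]
      abel
    beta_reduce
    rw [hzw t, ← (hfix ((z 0).1, (z 0).2.1, (z h).2.1) w).1 (by rw [hb, hw]), hb]
  · set w := W (m, x, x) with hwdef
    have hw : ‖w‖ ≤ C := by
      rw [ContinuousMap.norm_le _ ((norm_nonneg _).trans (hC 0))]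
      intro t
      rw [← DFunLike.congr_fun ((hfix (m, x, x) w).2 rfl) t]
      exact hC _
    have hv := norm_boundaryState_le hlt.le hlt m x w
    have e := stateCurve_sub hlt.le (boundaryState hlt.le ((m, x, x), w)) w t
    simp only [boundaryState_apply] at e hv
    beta_reduce
    rw [← hwdef, boundaryState_apply, e]
    refine (ContinuousMap.norm_coe_le_norm _ t).trans ((norm_stateCurve_le hlt.le h1 _ w).trans ?_)
    nlinarith [mul_le_mul_of_nonneg_left hw hlt.le]

end SecondOrder

/-! ### Charts adapted to a submersion -/

section FibreChart

universe u

variable {E : Type u} [NormedAddCommGroup E] [NormedSpace ℝ E]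
  {B : Type*} [NormedAddCommGroup B] [NormedSpace ℝ B]
  {F : Type*} [NormedAddCommGroup F] [NormedSpace ℝ F]
  {Q : Type*} [TopologicalSpace Q] [ChartedSpace E Q]
  {M : Type*} [TopologicalSpace M] [ChartedSpace B M]

/-- A chart `χ = (m, x)` of `Q` is adapted to `π : Q → M` if its first component is a coordinate
on the base: it separates the fibres of `π`, and its differential has the same kernel as that
of `π`. -/
structure IsFibreChart (π : Q → M) (χ : OpenPartialHomeomorph Q (B × F)) : Prop where
  contMDiffOn : ContMDiffOn 𝓘(ℝ, E) 𝓘(ℝ, B × F) ∞ χ χ.source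
  contMDiffOn_symm : ContMDiffOn 𝓘(ℝ, B × F) 𝓘(ℝ, E) ∞ χ.symm χ.target
  fst_eq_iff : ∀ q ∈ χ.source, ∀ q' ∈ χ.source, (χ q).1 = (χ q').1 ↔ π q = π q'
  mem_verticalBundle_iff : ∀ v : TangentBundle 𝓘(ℝ, E) Q, v.proj ∈ χ.source →
    (v ∈ verticalBundle (E := E) (B := B) π ↔
      (mfderiv 𝓘(ℝ, E) 𝓘(ℝ, B × F) χ v.proj v.2).1 = 0)

/-- The normal form of a submersion provides fibre charts at all points. -/
theorem exists_isFibreChart [FiniteDimensional ℝ E] [IsManifold 𝓘(ℝ, E) ∞ Q]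
    [IsManifold 𝓘(ℝ, B) ∞ M] {π : Q → M}
    (hπ : Manifold.IsSubmersion 𝓘(ℝ, E) 𝓘(ℝ, B) ∞ π) (q₀ : Q) :
    ∃ (F : Type u) (_ : NormedAddCommGroup F) (_ : NormedSpace ℝ F) (_ : FiniteDimensional ℝ F)
      (χ : OpenPartialHomeomorph Q (B × F)), IsFibreChart (E := E) π χ ∧ q₀ ∈ χ.source := by
  obtain ⟨F, _, _, hF⟩ := hπ
  have hs := hF q₀
  set φ := hs.domChart
  set ψ := hs.codChart
  set L := hs.equiv
  have hfd : FiniteDimensional ℝ F :=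
    Module.Finite.of_surjective ((ContinuousLinearMap.snd ℝ B F ∘L (L : E →L[ℝ] B × F)) : E →ₗ[ℝ] F)
      (Prod.snd_surjective.comp L.surjective)
  let χ : OpenPartialHomeomorph Q (B × F) := φ.transHomeomorph L.toHomeomorph
  have hφ : ContMDiffOn 𝓘(ℝ, E) 𝓘(ℝ, E) ∞ φ φ.source :=
    contMDiffOn_of_mem_maximalAtlas hs.domChart_mem_maximalAtlas
  have hφ' : ContMDiffOn 𝓘(ℝ, E) 𝓘(ℝ, E) ∞ φ.symm φ.target :=
    contMDiffOn_symm_of_mem_maximalAtlas hs.domChart_mem_maximalAtlas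
  have hψ : ContMDiffOn 𝓘(ℝ, B) 𝓘(ℝ, B) ∞ ψ ψ.source :=
    contMDiffOn_of_mem_maximalAtlas hs.codChart_mem_maximalAtlas
  have hψ' : ContMDiffOn 𝓘(ℝ, B) 𝓘(ℝ, B) ∞ ψ.symm ψ.target :=
    contMDiffOn_symm_of_mem_maximalAtlas hs.codChart_mem_maximalAtlas
  have hmaps : Set.MapsTo π φ.source ψ.source := hs.mapsto_domChart_source_codChart_source
  have hfst : ∀ q ∈ φ.source, (χ q).1 = ψ (π q) := fun q hq ↦ by
    have hx : φ q ∈ (φ.extend 𝓘(ℝ, E)).target := by simpa using φ.map_source hq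
    have h1 : ψ (π (φ.symm (φ q))) = (L (φ q)).1 := hs.writtenInCharts hx
    rw [φ.left_inv hq] at h1
    exact h1.symm
  have hχ : ContMDiffOn 𝓘(ℝ, E) 𝓘(ℝ, B × F) ∞ χ χ.source :=
    L.contDiff.contMDiff.comp_contMDiffOn hφ
  have hχ' : ContMDiffOn 𝓘(ℝ, B × F) 𝓘(ℝ, E) ∞ χ.symm χ.target :=
    hφ'.comp L.symm.contDiff.contMDiff.contMDiffOn fun z hz ↦ hz
  refine ⟨F, _, _, hfd, χ, ⟨hχ, hχ', fun q hq q' hq' ↦ ?_, fun v hv ↦ ?_⟩,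
    hs.mem_domChart_source⟩
  · rw [hfst q hq, hfst q' hq']
    exact ⟨fun h ↦ ψ.injOn (hmaps hq) (hmaps hq') h, fun h ↦ by rw [h]⟩
  · have hψd : ψ.MDifferentiable 𝓘(ℝ, B) 𝓘(ℝ, B) :=
      ⟨hψ.mdifferentiableOn (by simp), hψ'.mdifferentiableOn (by simp)⟩
    have hχd : MDifferentiableAt 𝓘(ℝ, E) 𝓘(ℝ, B × F) χ v.proj :=
      (hχ.contMDiffAt (χ.open_source.mem_nhds hv)).mdifferentiableAt (by simp)
    have hπd : MDifferentiableAt 𝓘(ℝ, E) 𝓘(ℝ, B) π v.proj :=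
      (hs.contMDiffOn.contMDiffAt (φ.open_source.mem_nhds hv)).mdifferentiableAt (by simp)
    have h1 : HasMFDerivAt 𝓘(ℝ, E) 𝓘(ℝ, B) (fun q ↦ (χ q).1) v.proj
        ((ContinuousLinearMap.fst ℝ B F) ∘L mfderiv 𝓘(ℝ, E) 𝓘(ℝ, B × F) χ v.proj) :=
      (ContinuousLinearMap.hasMFDerivAt (ContinuousLinearMap.fst ℝ B F)).comp v.proj
        hχd.hasMFDerivAt
    have h2 : HasMFDerivAt 𝓘(ℝ, E) 𝓘(ℝ, B) (ψ ∘ π) v.proj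
        ((mfderiv 𝓘(ℝ, B) 𝓘(ℝ, B) ψ (π v.proj)) ∘L mfderiv 𝓘(ℝ, E) 𝓘(ℝ, B) π v.proj) :=
      (hψd.mdifferentiableAt (hmaps hv)).hasMFDerivAt.comp v.proj hπd.hasMFDerivAt
    have h3 : (ψ ∘ π) =ᶠ[𝓝 v.proj] fun q ↦ (χ q).1 :=
      Filter.eventually_of_mem (φ.open_source.mem_nhds hv) fun q hq ↦ (hfst q hq).symm
    have h4 := congrArg (fun A ↦ A v.2) (hasMFDerivAt_unique h2 (h1.congr_of_eventuallyEq h3))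
    change mfderiv 𝓘(ℝ, E) 𝓘(ℝ, B) π v.proj v.2 = 0 ↔
      (mfderiv 𝓘(ℝ, E) 𝓘(ℝ, B × F) χ v.proj v.2).1 = 0
    have h5 : (mfderiv 𝓘(ℝ, E) 𝓘(ℝ, B × F) χ v.proj v.2).1 =
      mfderiv 𝓘(ℝ, B) 𝓘(ℝ, B) ψ (π v.proj) (mfderiv 𝓘(ℝ, E) 𝓘(ℝ, B) π v.proj v.2) := h4.symm
    rw [h5]
    exact (map_eq_zero_iff _ (hψd.mfderiv_injective (hmaps hv))).symm

/-- The coordinates `(m, x, v)` of a tangent vector in a fibre chart `(m, x)`. On a vertical vector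
the missing component of the velocity vanishes. -/
noncomputable def toState (χ : OpenPartialHomeomorph Q (B × F)) (a : TangentBundle 𝓘(ℝ, E) Q) :
    B × F × F :=
  ((χ a.proj).1, (χ a.proj).2,
    Prod.snd (α := B) (β := F) (mfderiv 𝓘(ℝ, E) 𝓘(ℝ, B × F) χ a.proj a.2))

/-- The vertical vector with coordinates `(m, x, v)` in a fibre chart. -/
noncomputable def ofState (χ : OpenPartialHomeomorph Q (B × F)) (z : B × F × F) :
    TangentBundle 𝓘(ℝ, E) Q :=
  ⟨χ.symm (z.1, z.2.1), mfderiv 𝓘(ℝ, B × F) 𝓘(ℝ, E) χ.symm (z.1, z.2.1)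
    ((0, z.2.2) : B × F)⟩

/-- The coordinates of the vertical vectors over the domain of the fibre chart. -/
def stateDomain (χ : OpenPartialHomeomorph Q (B × F)) : Set (B × F × F) :=
  {z | (z.1, z.2.1) ∈ χ.target}

variable (E) in
/-- The tangent vectors over the domain of the fibre chart. -/
def vectorDomain (χ : OpenPartialHomeomorph Q (B × F)) : Set (TangentBundle 𝓘(ℝ, E) Q) :=
  {a | a.proj ∈ χ.source}

variable {π : Q → M} {χ : OpenPartialHomeomorph Q (B × F)}

omit [NormedSpace ℝ B] [NormedSpace ℝ F] in
theorem isOpen_stateDomain : IsOpen (stateDomain χ) :=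
  χ.open_target.preimage (by fun_prop)

theorem IsFibreChart.mdifferentiable (hχ : IsFibreChart (E := E) π χ) :
    χ.MDifferentiable 𝓘(ℝ, E) 𝓘(ℝ, B × F) :=
  ⟨hχ.contMDiffOn.mdifferentiableOn (by simp), hχ.contMDiffOn_symm.mdifferentiableOn (by simp)⟩

theorem IsFibreChart.mapsTo_ofState (hχ : IsFibreChart (E := E) π χ) :
    Set.MapsTo (ofState (E := E) χ) (stateDomain χ)
      (vectorDomain E χ ∩ verticalBundle (E := E) (B := B) π) := by
  intro z hz
  have h1 : (ofState (E := E) χ z).proj ∈ χ.source := χ.map_target hz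
  refine ⟨h1, (hχ.mem_verticalBundle_iff _ h1).2 ?_⟩
  have := hχ.mdifferentiable.symm.symm_comp_deriv hz
  have h2 := congrArg (fun A : B × F →L[ℝ] B × F ↦ A (0, z.2.2)) this
  exact congrArg Prod.fst h2

theorem IsFibreChart.toState_ofState (hχ : IsFibreChart (E := E) π χ) {z : B × F × F}
    (hz : z ∈ stateDomain χ) : toState χ (ofState (E := E) χ z) = z := by
  have h1 : χ (χ.symm (z.1, z.2.1)) = (z.1, z.2.1) := χ.right_inv hz
  have := hχ.mdifferentiable.symm.symm_comp_deriv hz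
  have h2 := congrArg (fun A : B × F →L[ℝ] B × F ↦ A (0, z.2.2)) this
  exact Prod.ext (congrArg Prod.fst h1 :)
    (Prod.ext (congrArg Prod.snd h1 :) (congrArg Prod.snd h2 :))

theorem toState_mem_stateDomain {a : TangentBundle 𝓘(ℝ, E) Q} (ha : a ∈ vectorDomain E χ) :
    toState χ a ∈ stateDomain χ :=
  χ.map_source ha

theorem IsFibreChart.ofState_toState (hχ : IsFibreChart (E := E) π χ)
    {a : TangentBundle 𝓘(ℝ, E) Q} (ha : a ∈ vectorDomain E χ)
    (hv : a ∈ verticalBundle (E := E) (B := B) π) : ofState χ (toState χ a) = a := by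
  obtain ⟨q, w⟩ := a
  have h0 : ((0, (toState χ (⟨q, w⟩ : TangentBundle 𝓘(ℝ, E) Q)).2.2) : B × F) =
      mfderiv 𝓘(ℝ, E) 𝓘(ℝ, B × F) χ q w :=
    Prod.ext ((hχ.mem_verticalBundle_iff _ ha).1 hv).symm rfl
  have h1 : χ.symm (χ q) = q := χ.left_inv ha
  have h2 := congrArg (fun A : E →L[ℝ] E ↦ A w) (hχ.mdifferentiable.symm_comp_deriv ha)
  have h3 : ofState χ (toState χ (⟨q, w⟩ : TangentBundle 𝓘(ℝ, E) Q)) =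
      ⟨χ.symm (χ q), mfderiv 𝓘(ℝ, B × F) 𝓘(ℝ, E) χ.symm (χ q)
        ((0, (toState χ (⟨q, w⟩ : TangentBundle 𝓘(ℝ, E) Q)).2.2) : B × F)⟩ := rfl
  rw [h3, h0]
  exact Bundle.TotalSpace.ext h1 (heq_of_eq h2)

end FibreChart

/-! ### Second order vector fields in coordinates -/

section SmoothCoordinates

universe u

variable {E : Type u} [NormedAddCommGroup E] [NormedSpace ℝ E]
  {B : Type*} [NormedAddCommGroup B] [NormedSpace ℝ B]
  {F : Type*} [NormedAddCommGroup F] [NormedSpace ℝ F]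
  {Q : Type*} [TopologicalSpace Q] [ChartedSpace E Q] [IsManifold 𝓘(ℝ, E) ∞ Q]
  {M : Type*} [TopologicalSpace M] [ChartedSpace B M]
  {π : Q → M} {χ : OpenPartialHomeomorph Q (B × F)}

omit [NormedSpace ℝ B] [NormedSpace ℝ F] in
theorem isOpen_vectorDomain : IsOpen (vectorDomain E χ) :=
  χ.open_source.preimage (FiberBundle.continuous_proj E (TangentSpace 𝓘(ℝ, E)))

theorem contMDiff_proj_tangentBundle :
    ContMDiff (𝓘(ℝ, E)).tangent 𝓘(ℝ, E) ∞ (fun v : TangentBundle 𝓘(ℝ, E) Q ↦ v.proj) :=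
  Bundle.contMDiff_proj (TangentSpace 𝓘(ℝ, E))

theorem IsFibreChart.contMDiffOn_toState (hχ : IsFibreChart (E := E) π χ) :
    ContMDiffOn (𝓘(ℝ, E)).tangent 𝓘(ℝ, B × F × F) ∞ (toState χ) (vectorDomain E χ) := by
  have h1 : ContMDiffOn (𝓘(ℝ, E)).tangent 𝓘(ℝ, B × F) ∞
      (fun a : TangentBundle 𝓘(ℝ, E) Q ↦ χ a.proj) (vectorDomain E χ) :=
    hχ.contMDiffOn.comp contMDiff_proj_tangentBundle.contMDiffOn fun a ha ↦ ha
  have h2 := hχ.contMDiffOn.contMDiffOn_tangentMapWithin (m := ∞) (by simp)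
    χ.open_source.uniqueMDiffOn
  have h3 : ContMDiffOn (𝓘(ℝ, E)).tangent 𝓘(ℝ, B × F) ∞
      (fun a : TangentBundle 𝓘(ℝ, E) Q ↦ (mfderiv 𝓘(ℝ, E) 𝓘(ℝ, B × F) χ a.proj a.2 : B × F))
      (vectorDomain E χ) := by
    refine ((contMDiff_snd_tangentBundle_modelSpace (B × F) 𝓘(ℝ, B × F)).comp_contMDiffOn h2).congr
      fun a ha ↦ ?_
    exact (congrArg (fun A : E →L[ℝ] B × F ↦ A a.2)
      (mfderivWithin_of_isOpen χ.open_source ha)).symm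
  exact (contDiff_fst.contMDiff.comp_contMDiffOn h1).prodMk_space
    ((contDiff_snd.contMDiff.comp_contMDiffOn h1).prodMk_space
      (contDiff_snd.contMDiff.comp_contMDiffOn h3))

theorem IsFibreChart.contMDiffOn_ofState (hχ : IsFibreChart (E := E) π χ) :
    ContMDiffOn 𝓘(ℝ, B × F × F) (𝓘(ℝ, E)).tangent ∞ (ofState (E := E) χ) (stateDomain χ) := by
  have h2 := hχ.contMDiffOn_symm.contMDiffOn_tangentMapWithin (m := ∞) (by simp)
    χ.open_target.uniqueMDiffOn
  have h0 : ContMDiff 𝓘(ℝ, B × F × F) (𝓘(ℝ, B × F)).tangent ∞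
      (fun z : B × F × F ↦ (⟨(z.1, z.2.1), (0, z.2.2)⟩ : TangentBundle 𝓘(ℝ, B × F) (B × F))) := by
    let A : B × F × F →L[ℝ] B × F :=
      (ContinuousLinearMap.fst ℝ B (F × F)).prod (.fst ℝ F F ∘L .snd ℝ B (F × F))
    have h3 : ContMDiff 𝓘(ℝ, B × F × F) (𝓘(ℝ, B × F × F)).tangent ∞
        (fun z : B × F × F ↦
          (⟨z, ((0, z.2.2, 0) : B × F × F)⟩ : TangentBundle 𝓘(ℝ, B × F × F) (B × F × F))) :=
      contMDiff_vectorSpace_iff_contDiff.2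
        (contDiff_const.prodMk ((contDiff_snd.comp contDiff_snd).prodMk contDiff_const))
    refine ((A.contMDiff.contMDiff_tangentMap (m := ∞) (n := ∞) (by simp)).comp h3).congr fun z ↦ ?_
    exact Bundle.TotalSpace.ext rfl (heq_of_eq
      (congrArg (fun L : B × F × F →L[ℝ] B × F ↦ L (0, z.2.2, 0)) A.mfderiv_eq).symm)
  refine (h2.comp h0.contMDiffOn fun z hz ↦ hz).congr fun z hz ↦ ?_
  simp only [Function.comp_apply, tangentMapWithin]
  rw [mfderivWithin_of_isOpen χ.open_target hz]
  rfl

/-- The acceleration `f (m, x, v)` of a second order vector field, in a fibre chart. -/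
noncomputable def acceleration (χ : OpenPartialHomeomorph Q (B × F)) (Γ : VelocityField (E := E) Q)
    (z : B × F × F) : F :=
  Prod.snd (α := F) (β := F) (Prod.snd (α := B) (β := F × F)
    (mfderiv (𝓘(ℝ, E)).tangent 𝓘(ℝ, B × F × F) (toState χ) (ofState χ z) (Γ (ofState χ z))))

variable {Γ : VelocityField (E := E) Q}

theorem IsFibreChart.contDiffOn_acceleration (hχ : IsFibreChart (E := E) π χ)
    (hΓ : IsSODE (B := B) π Γ) : ContDiffOn ℝ ∞ (acceleration χ Γ) (stateDomain χ) := by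
  rw [← contMDiffOn_iff_contDiffOn]
  have h1 := hχ.contMDiffOn_toState.contMDiffOn_tangentMapWithin (m := ∞) (by simp)
    (isOpen_vectorDomain (χ := χ)).uniqueMDiffOn
  have h2 := h1.comp (hΓ.smooth.comp hχ.contMDiffOn_ofState fun z hz ↦ (hχ.mapsTo_ofState hz).2)
    fun z hz ↦ (hχ.mapsTo_ofState hz).1
  have h3 := (contMDiff_snd_tangentBundle_modelSpace (B × F × F) 𝓘(ℝ, B × F × F)).comp_contMDiffOn
    h2
  refine ((contDiff_snd.comp contDiff_snd).contMDiff.comp_contMDiffOn h3).congr fun z hz ↦ ?_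
  exact (congrArg (fun A : E × E →L[ℝ] B × F × F ↦ (A (Γ (ofState χ z))).2.2)
    (mfderivWithin_of_isOpen isOpen_vectorDomain (hχ.mapsTo_ofState hz).1)).symm

/-- In coordinates, `Γ` is the vector field `(0, v, f (m, x, v))`: its first two components
come from the second order condition. -/
theorem IsFibreChart.mfderiv_toState (hχ : IsFibreChart (E := E) π χ) (hΓ : IsSODE (B := B) π Γ)
    {a : TangentBundle 𝓘(ℝ, E) Q} (ha : a ∈ vectorDomain E χ)
    (hv : a ∈ verticalBundle (E := E) (B := B) π) :
    mfderiv (𝓘(ℝ, E)).tangent 𝓘(ℝ, B × F × F) (toState χ) a (Γ a) =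
      ((0, (toState χ a).2.2, acceleration χ Γ (toState χ a)) : B × F × F) := by
  have hd : MDifferentiableAt (𝓘(ℝ, E)).tangent 𝓘(ℝ, B × F × F) (toState χ) a :=
    (hχ.contMDiffOn_toState.contMDiffAt (isOpen_vectorDomain.mem_nhds ha)).mdifferentiableAt
      (by simp)
  have hproj : MDifferentiableAt (𝓘(ℝ, E)).tangent 𝓘(ℝ, E)
      (fun v : TangentBundle 𝓘(ℝ, E) Q ↦ v.proj) a :=
    contMDiff_proj_tangentBundle.mdifferentiableAt (by simp)
  let A : B × F × F →L[ℝ] B × F :=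
    (ContinuousLinearMap.fst ℝ B (F × F)).prod (.fst ℝ F F ∘L .snd ℝ B (F × F))
  have h1 : HasMFDerivAt (𝓘(ℝ, E)).tangent 𝓘(ℝ, B × F)
      (fun v : TangentBundle 𝓘(ℝ, E) Q ↦ χ v.proj) a
      (A ∘L mfderiv (𝓘(ℝ, E)).tangent 𝓘(ℝ, B × F × F) (toState χ) a) :=
    A.hasMFDerivAt.comp a hd.hasMFDerivAt
  have h2 : HasMFDerivAt (𝓘(ℝ, E)).tangent 𝓘(ℝ, B × F)
      (fun v : TangentBundle 𝓘(ℝ, E) Q ↦ χ v.proj) a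
      (mfderiv 𝓘(ℝ, E) 𝓘(ℝ, B × F) χ a.proj ∘L
        mfderiv (𝓘(ℝ, E)).tangent 𝓘(ℝ, E) (fun v : TangentBundle 𝓘(ℝ, E) Q ↦ v.proj) a) :=
    (hχ.mdifferentiable.mdifferentiableAt ha).hasMFDerivAt.comp a hproj.hasMFDerivAt
  have h3 : A (mfderiv (𝓘(ℝ, E)).tangent 𝓘(ℝ, B × F × F) (toState χ) a (Γ a)) =
      mfderiv 𝓘(ℝ, E) 𝓘(ℝ, B × F) χ a.proj a.2 := by
    rw [← hΓ.sode a hv]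
    exact congrArg (fun A : E × E →L[ℝ] B × F ↦ A (Γ a)) (hasMFDerivAt_unique h1 h2)
  refine Prod.ext ?_ (Prod.ext ?_ ?_)
  · exact (congrArg Prod.fst h3 :).trans ((hχ.mem_verticalBundle_iff a ha).1 hv)
  · exact (congrArg Prod.snd h3 :)
  · simp only [acceleration]
    rw [hχ.ofState_toState ha hv]

/-- Since `Γ` is tangent to the vertical bundle, it is determined by its expression in
coordinates: along a curve in the vertical bundle, `ofState ∘ toState` is the identity. -/
theorem IsFibreChart.mfderiv_ofState (hχ : IsFibreChart (E := E) π χ) (hΓ : IsSODE (B := B) π Γ)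
    {a : TangentBundle 𝓘(ℝ, E) Q} (ha : a ∈ vectorDomain E χ)
    (hv : a ∈ verticalBundle (E := E) (B := B) π) :
    mfderiv 𝓘(ℝ, B × F × F) (𝓘(ℝ, E)).tangent (ofState (E := E) χ) (toState χ a)
      ((0, (toState χ a).2.2, acceleration χ Γ (toState χ a)) : B × F × F) = Γ a := by
  rw [← hχ.mfderiv_toState hΓ ha hv]
  obtain ⟨c, rfl, hcs, hcS, hc⟩ := hΓ.tangent a hv
  have hd : HasMFDerivAt (𝓘(ℝ, E)).tangent 𝓘(ℝ, B × F × F) (toState χ) (c 0)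
      (mfderiv (𝓘(ℝ, E)).tangent 𝓘(ℝ, B × F × F) (toState χ) (c 0)) :=
    ((hχ.contMDiffOn_toState.contMDiffAt (isOpen_vectorDomain.mem_nhds ha)).mdifferentiableAt
      (by simp)).hasMFDerivAt
  have hd' : HasMFDerivAt 𝓘(ℝ, B × F × F) (𝓘(ℝ, E)).tangent (ofState (E := E) χ) (toState χ (c 0))
      (mfderiv 𝓘(ℝ, B × F × F) (𝓘(ℝ, E)).tangent (ofState (E := E) χ) (toState χ (c 0))) :=
    ((hχ.contMDiffOn_ofState.contMDiffAt (isOpen_stateDomain.mem_nhds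
      (toState_mem_stateDomain ha))).mdifferentiableAt (by simp)).hasMFDerivAt
  have h1 := hd'.comp (0 : ℝ) (hd.comp (0 : ℝ) hc)
  have h2 : c =ᶠ[𝓝 0] ofState χ ∘ toState χ ∘ c := by
    filter_upwards [hcS, hcs.continuousAt.eventually (isOpen_vectorDomain.mem_nhds ha)]
      with t ht ht'
    exact (hχ.ofState_toState ht' ht).symm
  have h3 := congrArg (fun A : ℝ →L[ℝ] E × E ↦ A 1)
    (hasMFDerivAt_unique (h1.congr_of_eventuallyEq h2) hc)
  let D : E × E →L[ℝ] B × F × F :=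
    mfderiv (𝓘(ℝ, E)).tangent 𝓘(ℝ, B × F × F) (toState χ) (c 0)
  let D' : B × F × F →L[ℝ] E × E :=
    mfderiv 𝓘(ℝ, B × F × F) (𝓘(ℝ, E)).tangent (ofState (E := E) χ) (toState χ (c 0))
  have e : (1 : ℝ) • (Γ (c 0) : E × E) = Γ (c 0) := one_smul ℝ _
  exact (congrArg (fun v : E × E ↦ D' (D v)) e).symm.trans (h3.trans e)

/-- A solution of the second order equation in a fibre chart is an integral curve. -/
theorem IsFibreChart.isIntegralCurve_ofState (hχ : IsFibreChart (E := E) π χ)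
    (hΓ : IsSODE (B := B) π Γ) {h : ℝ} {z : ℝ → B × F × F}
    (hz : IsSolutionOn (acceleration χ Γ) h z) (hzΩ : ∀ t ∈ Set.Icc 0 h, z t ∈ stateDomain χ) :
    IsIntegralCurve (B := B) π Γ h (ofState χ ∘ z) := by
  refine ⟨fun t ht ↦ (hχ.mapsTo_ofState (hzΩ t ht)).2, fun t ht ↦ ?_⟩
  have hd' : HasMFDerivAt 𝓘(ℝ, B × F × F) (𝓘(ℝ, E)).tangent (ofState (E := E) χ) (z t)
      (mfderiv 𝓘(ℝ, B × F × F) (𝓘(ℝ, E)).tangent (ofState (E := E) χ) (z t)) :=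
    ((hχ.contMDiffOn_ofState.contMDiffAt (isOpen_stateDomain.mem_nhds
      (hzΩ t ht))).mdifferentiableAt (by simp)).hasMFDerivAt
  refine (hd'.comp_hasMFDerivWithinAt t
    (hz t ht).hasFDerivWithinAt.hasMFDerivWithinAt).congr_mfderiv ?_
  obtain ⟨ha, hv⟩ := hχ.mapsTo_ofState (hzΩ t ht)
  have h1 := hχ.mfderiv_ofState hΓ ha hv
  rw [hχ.toState_ofState (hzΩ t ht)] at h1
  let D' : B × F × F →L[ℝ] E × E :=
    mfderiv 𝓘(ℝ, B × F × F) (𝓘(ℝ, E)).tangent (ofState (E := E) χ) (z t)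
  have e : (1 : ℝ) • (Γ (ofState χ (z t)) : E × E) = Γ (ofState χ (z t)) := one_smul ℝ _
  exact ContinuousLinearMap.ext_ring ((congrArg D' (one_smul ℝ _)).trans (h1.trans e.symm))

/-- In a fibre chart, an integral curve solves the second order equation. -/
theorem IsFibreChart.hasDerivWithinAt_toState (hχ : IsFibreChart (E := E) π χ)
    (hΓ : IsSODE (B := B) π Γ) {h : ℝ} {c : ℝ → TangentBundle 𝓘(ℝ, E) Q}
    (hc : IsIntegralCurve (B := B) π Γ h c) {t : ℝ} (ht : t ∈ Set.Icc 0 h)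
    (hct : c t ∈ vectorDomain E χ) :
    HasDerivWithinAt (toState χ ∘ c)
      (0, (toState χ (c t)).2.2, acceleration χ Γ (toState χ (c t))) (Set.Icc 0 h) t := by
  have hd : HasMFDerivAt (𝓘(ℝ, E)).tangent 𝓘(ℝ, B × F × F) (toState χ) (c t)
      (mfderiv (𝓘(ℝ, E)).tangent 𝓘(ℝ, B × F × F) (toState χ) (c t)) :=
    ((hχ.contMDiffOn_toState.contMDiffAt (isOpen_vectorDomain.mem_nhds hct)).mdifferentiableAt
      (by simp)).hasMFDerivAt
  let D : E × E →L[ℝ] B × F × F :=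
    mfderiv (𝓘(ℝ, E)).tangent 𝓘(ℝ, B × F × F) (toState χ) (c t)
  have h1 : HasFDerivWithinAt (toState χ ∘ c)
      (D ∘L (1 : ℝ →L[ℝ] ℝ).smulRight (Γ (c t) : E × E)) (Set.Icc 0 h) t :=
    (hd.comp_hasMFDerivWithinAt t (hc.2 t ht)).hasFDerivWithinAt
  have e : D ((1 : ℝ) • (Γ (c t) : E × E)) = D (Γ (c t)) := congrArg D (one_smul ℝ _)
  rw [← hχ.mfderiv_toState hΓ hct (hc.1 t ht)]
  exact h1.hasDerivWithinAt.congr_deriv e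

theorem IsIntegralCurve.continuousOn {h : ℝ} {c : ℝ → TangentBundle 𝓘(ℝ, E) Q}
    (hc : IsIntegralCurve (B := B) π Γ h c) : ContinuousOn c (Set.Icc 0 h) :=
  fun t ht ↦ (hc.2 t ht).continuousWithinAt

/-- Integral curves of a second order vector field are the tangent lifts of their projections. -/
theorem IsIntegralCurve.tangentLift_proj (hΓ : IsSODE (B := B) π Γ) {h : ℝ} (hh : 0 < h)
    {c : ℝ → TangentBundle 𝓘(ℝ, E) Q} (hc : IsIntegralCurve (B := B) π Γ h c) :
    Set.EqOn (tangentLift (E := E) h fun t ↦ (c t).proj) c (Set.Icc 0 h) := by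
  intro t ht
  have hproj : HasMFDerivAt (𝓘(ℝ, E)).tangent 𝓘(ℝ, E)
      (fun v : TangentBundle 𝓘(ℝ, E) Q ↦ v.proj) (c t)
      (mfderiv (𝓘(ℝ, E)).tangent 𝓘(ℝ, E) (fun v : TangentBundle 𝓘(ℝ, E) Q ↦ v.proj) (c t)) :=
    (contMDiff_proj_tangentBundle.mdifferentiableAt (by simp)).hasMFDerivAt
  have h1 := (hproj.comp_hasMFDerivWithinAt t (hc.2 t ht)).mfderivWithin
    (uniqueMDiffWithinAt_iff_uniqueDiffWithinAt.2 (uniqueDiffOn_Icc hh t ht))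
  have h2 := congrArg (fun A : ℝ →L[ℝ] E ↦ A 1) h1
  refine Bundle.TotalSpace.ext rfl (heq_of_eq (h2.trans ?_))
  rw [← hΓ.sode (c t) (hc.1 t ht)]
  let D : E × E →L[ℝ] E :=
    mfderiv (𝓘(ℝ, E)).tangent 𝓘(ℝ, E) (fun v : TangentBundle 𝓘(ℝ, E) Q ↦ v.proj) (c t)
  exact congrArg D (one_smul ℝ (Γ (c t) : E × E))

theorem IsIntegralCurve.congr {h : ℝ} {c c' : ℝ → TangentBundle 𝓘(ℝ, E) Q}
    (hc : IsIntegralCurve (B := B) π Γ h c) (hcc' : Set.EqOn c' c (Set.Icc 0 h)) :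
    IsIntegralCurve (B := B) π Γ h c' := by
  refine ⟨fun t ht ↦ hcc' ht ▸ hc.1 t ht, fun t ht ↦ ?_⟩
  have := (hc.2 t ht).congr_of_eventuallyEq (hcc'.eventuallyEq_of_mem self_mem_nhdsWithin)
    (hcc' ht)
  refine this.congr_mfderiv ?_
  rw [hcc' ht]

end SmoothCoordinates

/-! ### Cut-off -/

section Cutoff

/-- A smooth function on an open set agrees, near a given point, with a bounded Lipschitz smooth
function on the whole space. -/
theorem exists_contDiff_eqOn_closedBall {X Y : Type*} [NormedAddCommGroup X] [NormedSpace ℝ X]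
    [FiniteDimensional ℝ X] [NormedAddCommGroup Y] [NormedSpace ℝ Y] {f : X → Y} {Ω : Set X}
    (hΩ : IsOpen Ω) (hf : ContDiffOn ℝ ∞ f Ω) {x : X} (hx : x ∈ Ω) :
    ∃ (R : ℝ) (g : C(X, Y)) (L : NNReal) (C : ℝ), 0 < R ∧ Metric.closedBall x R ⊆ Ω ∧
      ContDiff ℝ ∞ g ∧ Set.EqOn g f (Metric.closedBall x R) ∧ LipschitzWith L g ∧
      0 ≤ C ∧ ∀ y, ‖g y‖ ≤ C := by
  obtain ⟨r, hr, hrΩ⟩ := Metric.nhds_basis_closedBall.mem_iff.1 (hΩ.mem_nhds hx)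
  let b : ContDiffBump x := ⟨r / 2, r, by positivity, by linarith⟩
  have hg : ContDiff ℝ ∞ fun y ↦ b y • f y := by
    refine contDiff_iff_contDiffAt.2 fun y ↦ ?_
    by_cases hy : y ∈ Metric.closedBall x r
    · exact b.contDiffAt.smul (hf.contDiffAt (hΩ.mem_nhds (hrΩ hy)))
    · have : (fun y ↦ b y • f y) =ᶠ[𝓝 y] fun _ ↦ 0 := by
        filter_upwards [Metric.isClosed_closedBall.isOpen_compl.mem_nhds hy] with z hz
        rw [b.zero_of_le_dist, zero_smul]
        exact (not_le.1 (mt Metric.mem_closedBall.2 hz)).le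
      exact contDiffAt_const.congr_of_eventuallyEq this
  have hc : HasCompactSupport fun y ↦ b y • f y := b.hasCompactSupport.smul_right
  obtain ⟨L, hL⟩ := hg.lipschitzWith_of_hasCompactSupport hc (by simp)
  obtain ⟨C, hC⟩ := hc.exists_bound_of_continuous hg.continuous
  refine ⟨r / 2, ⟨_, hg.continuous⟩, L, C, by positivity,
    (Metric.closedBall_subset_closedBall (by linarith)).trans hrΩ, hg, fun y hy ↦ ?_, hL,
    (norm_nonneg _).trans (hC x), hC⟩
  change b y • f y = f y
  rw [b.one_of_mem_closedBall hy, one_smul]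

end Cutoff

/-! ### The boundary value map -/

section BoundaryMap

variable {P F : Type*} [NormedAddCommGroup P] [NormedSpace ℝ P] [CompleteSpace P]
  [NormedAddCommGroup F] [NormedSpace ℝ F] [CompleteSpace F]

/-- For a short time `h`, the map `e` that sends an initial state `(m, x 0, v 0)` to the boundary
values `(m, x 0, x h)` of the corresponding solution is a diffeomorphism, because its inverse `b` is
given by the solution of the boundary value problem. -/
theorem exists_boundary_diffeo (f : C(P × F × F, F)) (hf : ContDiff ℝ ∞ f)
    {L : NNReal} (hL : LipschitzWith L f) {C : ℝ} (hC : ∀ z, ‖f z‖ ≤ C) {h : ℝ}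
    (hlt : 0 < h) (h1 : h ≤ 1) (hLh : 2 * L * h < 1) :
    ∃ (Φ : P × F × F → C(Set.Icc 0 h, P × F × F)) (e b : P × F × F → P × F × F),
      Continuous Φ ∧ ContDiff ℝ ∞ e ∧ ContDiff ℝ ∞ b ∧ (∀ z, b (e z) = z) ∧ (∀ p, e (b p) = p) ∧
      (∀ z₀, IsSolutionOn f h (Set.IccExtend hlt.le (Φ z₀)) ∧
        Set.IccExtend hlt.le (Φ z₀) 0 = z₀) ∧
      (∀ z, IsSolutionOn f h z → e (z 0) = ((z 0).1, (z 0).2.1, (z h).2.1)) ∧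
      ∀ m x t, ‖Φ (b (m, x, x)) t - (m, x, 0)‖ ≤ 2 * h * C := by
  obtain ⟨Φ, hΦ, hΦs, hΦu⟩ := exists_contDiff_initialValue f hf hL hlt h1 hLh
  obtain ⟨Ψ, hΨ, hΨs, hΨu, hΨC⟩ := exists_contDiff_boundaryValue f hf hL hC hlt h1 hLh
  have ev : ∀ t : Set.Icc 0 h, ContDiff ℝ ∞ fun u : C(Set.Icc 0 h, P × F × F) ↦ u t :=
    fun t ↦ ContinuousLinearMap.contDiff
      (ContinuousMap.evalCLM ℝ t : C(Set.Icc 0 h, P × F × F) →L[ℝ] P × F × F)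
  have e0 : ∀ u : C(Set.Icc 0 h, P × F × F), Set.IccExtend hlt.le u 0 = u ⟨0, le_rfl, hlt.le⟩ :=
    fun u ↦ Set.IccExtend_of_mem hlt.le u ⟨le_rfl, hlt.le⟩
  have e1 : ∀ u : C(Set.Icc 0 h, P × F × F), Set.IccExtend hlt.le u h = u ⟨h, hlt.le, le_rfl⟩ :=
    fun u ↦ Set.IccExtend_of_mem hlt.le u ⟨hlt.le, le_rfl⟩
  let e : P × F × F → P × F × F := fun z ↦ (z.1, z.2.1, (Φ z ⟨h, hlt.le, le_rfl⟩).2.1)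
  let b : P × F × F → P × F × F := fun p ↦ Ψ p ⟨0, le_rfl, hlt.le⟩
  have he : ∀ z, IsSolutionOn f h z → e (z 0) = ((z 0).1, (z 0).2.1, (z h).2.1) := fun z hz ↦ by
    simp only [e, ← hΦu z hz]
  have hΦb : ∀ p t, Φ (b p) t = Ψ p t := fun p t ↦ by
    have := hΦu _ (hΨs p).1 t
    rw [Set.IccExtend_val, e0] at this
    exact this.symm
  refine ⟨Φ, e, b, hΦ.continuous, ?_, (ev _).comp hΨ, fun z ↦ ?_, fun p ↦ ?_,
    fun z ↦ ⟨(hΦs z).1, by rw [e0]; exact (hΦs z).2⟩, he, fun m x t ↦ ?_⟩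
  · exact contDiff_fst.prodMk ((contDiff_fst.comp contDiff_snd).prodMk
      ((contDiff_fst.comp contDiff_snd).comp ((ev _).comp hΦ)))
  · have := hΨu _ (hΦs z).1 ⟨0, le_rfl, hlt.le⟩
    simp only [e0, e1, (hΦs z).2] at this
    exact this.symm
  · have := he _ (hΨs p).1
    rw [e0, e1] at this
    obtain ⟨-, h1, h2, h3⟩ := hΨs p
    rw [h1, h2, h3] at this
    exact this
  · rw [hΦb]
    exact hΨC m x t

end BoundaryMap

/-! ### Uniqueness of integral curves -/

section Uniqueness

universe u

variable {E : Type u} [NormedAddCommGroup E] [NormedSpace ℝ E] [FiniteDimensional ℝ E]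
  {B : Type*} [NormedAddCommGroup B] [NormedSpace ℝ B]
  {Q : Type*} [TopologicalSpace Q] [ChartedSpace E Q] [IsManifold 𝓘(ℝ, E) ∞ Q] [T2Space Q]
  {M : Type*} [TopologicalSpace M] [ChartedSpace B M] [IsManifold 𝓘(ℝ, B) ∞ M]
  {π : Q → M} {Γ : VelocityField (E := E) Q}

omit [FiniteDimensional ℝ E] [T2Space Q] [IsManifold 𝓘(ℝ, B) ∞ M] in
/-- Two integral curves that agree at time `t` agree for a short time after `t`. -/
theorem IsIntegralCurve.eventually_eq {F : Type*} [NormedAddCommGroup F] [NormedSpace ℝ F]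
    {χ : OpenPartialHomeomorph Q (B × F)} (hχ : IsFibreChart (E := E) π χ)
    (hΓ : IsSODE (B := B) π Γ) {h : ℝ} {c c' : ℝ → TangentBundle 𝓘(ℝ, E) Q}
    (hc : IsIntegralCurve (B := B) π Γ h c) (hc' : IsIntegralCurve (B := B) π Γ h c')
    {t : ℝ} (ht : t ∈ Set.Ico 0 h) (hcc' : c' t = c t) (hct : c t ∈ vectorDomain E χ) :
    ∃ u > t, Set.EqOn c' c (Set.Icc t u) := by
  -- In the chart both curves solve the equation of a locally Lipschitz vector field.
  let X : B × F × F → B × F × F := fun z ↦ (0, z.2.2, acceleration χ Γ z)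
  have hX : ContDiffAt ℝ 1 X (toState χ (c t)) :=
    contDiffAt_const.prodMk ((contDiffAt_snd.comp _ contDiffAt_snd).prodMk
      (((hχ.contDiffOn_acceleration hΓ).contDiffAt (isOpen_stateDomain.mem_nhds
        (toState_mem_stateDomain hct))).of_le (by simp)))
  obtain ⟨L, N, hN, hL⟩ := hX.exists_lipschitzOnWith
  have hIcc : Set.Icc 0 h ∈ 𝓝[≥] t := Icc_mem_nhdsGE_of_mem ht
  have key : ∀ γ : ℝ → TangentBundle 𝓘(ℝ, E) Q, IsIntegralCurve (B := B) π Γ h γ → γ t = c t →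
      ∀ᶠ s in 𝓝[≥] t, γ s ∈ vectorDomain E χ ∧ toState χ (γ s) ∈ N := fun γ hγ hγt ↦ by
    have h1 : Filter.Tendsto γ (𝓝[≥] t) (𝓝 (c t)) := by
      rw [← hγt]
      exact (hγ.continuousOn t ⟨ht.1, ht.2.le⟩).mono_left (nhdsWithin_le_iff.2 hIcc)
    have h2 := (hχ.contMDiffOn_toState.continuousOn.continuousAt
      (isOpen_vectorDomain.mem_nhds hct)).tendsto.comp h1
    exact (h1.eventually (isOpen_vectorDomain.mem_nhds hct)).and (h2.eventually hN)
  obtain ⟨u, hu, hus⟩ := mem_nhdsGE_iff_exists_Icc_subset.1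
    (((key c hc rfl).and (key c' hc' hcc')).and hIcc)
  refine ⟨u, hu, ?_⟩
  have hsol : ∀ γ : ℝ → TangentBundle 𝓘(ℝ, E) Q, IsIntegralCurve (B := B) π Γ h γ →
      (∀ s ∈ Set.Icc t u, γ s ∈ vectorDomain E χ) →
      ContinuousOn (toState χ ∘ γ) (Set.Icc t u) ∧ ∀ s ∈ Set.Ico t u,
        HasDerivWithinAt (toState χ ∘ γ) (X ((toState χ ∘ γ) s)) (Set.Ici s) s := fun γ hγ hs ↦ by
    have h1 : ∀ s ∈ Set.Icc t u, HasDerivWithinAt (toState χ ∘ γ) (X ((toState χ ∘ γ) s))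
        (Set.Icc 0 h) s := fun s hsu ↦ hχ.hasDerivWithinAt_toState hΓ hγ (hus hsu).2 (hs s hsu)
    refine ⟨fun s hsu ↦ ((h1 s hsu).continuousWithinAt).mono fun s' hs' ↦ (hus hs').2,
      fun s hsu ↦ ?_⟩
    refine (h1 s ⟨hsu.1, hsu.2.le⟩).mono_of_mem_nhdsWithin ?_
    exact Filter.mem_of_superset (Icc_mem_nhdsGE_of_mem hsu) fun s' hs' ↦ (hus hs').2
  obtain ⟨h1, h2⟩ := hsol c hc fun s hs ↦ (hus hs).1.1.1
  obtain ⟨h3, h4⟩ := hsol c' hc' fun s hs ↦ (hus hs).1.2.1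
  have heq := ODE_solution_unique_of_mem_Icc_right (v := fun _ ↦ X) (s := fun _ ↦ N)
    (fun _ _ ↦ hL) h3 h4 (fun s hs ↦ (hus ⟨hs.1, hs.2.le⟩).1.2.2)
    h1 h2 (fun s hs ↦ (hus ⟨hs.1, hs.2.le⟩).1.1.2) (congrArg (toState χ) hcc')
  intro s hs
  rw [← hχ.ofState_toState (hus hs).1.2.1 (hc'.1 s (hus hs).2),
    ← hχ.ofState_toState (hus hs).1.1.1 (hc.1 s (hus hs).2)]
  exact congrArg (ofState χ) (heq hs)

/-- An integral curve in the vertical bundle is determined by its initial value. -/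
theorem IsIntegralCurve.eqOn (hπ : Manifold.IsSubmersion 𝓘(ℝ, E) 𝓘(ℝ, B) ∞ π)
    (hΓ : IsSODE (B := B) π Γ) {h : ℝ} {c c' : ℝ → TangentBundle 𝓘(ℝ, E) Q}
    (hc : IsIntegralCurve (B := B) π Γ h c) (hc' : IsIntegralCurve (B := B) π Γ h c')
    (h0 : c' 0 = c 0) : Set.EqOn c' c (Set.Icc 0 h) := by
  refine IsClosed.Icc_subset_of_forall_exists_gt (s := {t | c' t = c t}) ?_ h0 ?_
  · refine isClosed_of_closure_subset fun t ht ↦ ?_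
    have htI : t ∈ Set.Icc 0 h :=
      closure_minimal Set.inter_subset_right isClosed_Icc ht
    have hne : (𝓝[{t | c' t = c t} ∩ Set.Icc 0 h] t).NeBot := mem_closure_iff_nhdsWithin_neBot.1 ht
    have hle : 𝓝[{t | c' t = c t} ∩ Set.Icc 0 h] t ≤ 𝓝[Set.Icc 0 h] t :=
      nhdsWithin_mono t Set.inter_subset_right
    have h1 := (hc.continuousOn t htI).mono_left hle
    have h1' := (hc'.continuousOn t htI).mono_left hle
    have hev : ∀ᶠ s in 𝓝[{t | c' t = c t} ∩ Set.Icc 0 h] t, c' s = c s :=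
      Filter.eventually_of_mem self_mem_nhdsWithin fun s hs ↦ hs.1
    have hproj := FiberBundle.continuous_proj E (TangentSpace 𝓘(ℝ, E) : Q → Type _)
    -- The base points of the limits agree because `Q` is Hausdorff. The fibre components are then
    -- compared in a single chart.
    have h2 : (c' t).proj = (c t).proj :=
      tendsto_nhds_unique_of_eventuallyEq ((hproj.tendsto _).comp h1') ((hproj.tendsto _).comp h1)
        (hev.mono fun s hs ↦ congrArg Bundle.TotalSpace.proj hs)
    obtain ⟨F, _, _, _, χ, hχ, hq⟩ := exists_isFibreChart hπ (c t).proj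
    have hq' : c' t ∈ vectorDomain E χ := by
      rw [← h2] at hq
      exact hq
    have hcont : ∀ a ∈ vectorDomain E χ, Filter.Tendsto (toState χ) (𝓝 a) (𝓝 (toState χ a)) :=
      fun a ha ↦ hχ.contMDiffOn_toState.continuousOn.continuousAt (isOpen_vectorDomain.mem_nhds ha)
    have h3 : toState χ (c' t) = toState χ (c t) :=
      tendsto_nhds_unique_of_eventuallyEq ((hcont _ hq').comp h1') ((hcont _ hq).comp h1)
        (hev.mono fun s hs ↦ congrArg (toState χ) hs)
    refine ⟨?_, htI⟩
    rw [Set.mem_ofPred_eq, ← hχ.ofState_toState hq' (hc'.1 t htI), h3,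
      hχ.ofState_toState hq (hc.1 t htI)]
  · rintro t ⟨ht, htI⟩ y hy
    obtain ⟨F, _, _, _, χ, hχ, hq⟩ := exists_isFibreChart hπ (c t).proj
    obtain ⟨u, hu, hcu⟩ := hc.eventually_eq hχ hΓ hc' htI ht hq
    have hlt : t < min u y := lt_min hu hy
    exact ⟨min u y, hcu ⟨hlt.le, min_le_left _ _⟩, hlt, min_le_right _ _⟩

theorem IsIntegralCurve.flow_eq (hπ : Manifold.IsSubmersion 𝓘(ℝ, E) 𝓘(ℝ, B) ∞ π)
    (hΓ : IsSODE (B := B) π Γ) {h : ℝ} (hh : 0 ≤ h) {c : ℝ → TangentBundle 𝓘(ℝ, E) Q}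
    (hc : IsIntegralCurve (B := B) π Γ h c) : flow (B := B) π Γ h (c 0) = c h := by
  have hv : c 0 ∈ flowDomain (B := B) π Γ h := ⟨c, rfl, hc⟩
  rw [flow, dif_pos hv]
  exact hc.eqOn hπ hΓ hv.choose_spec.2 hv.choose_spec.1 ⟨hh, le_rfl⟩

end Uniqueness

/-! ### Pairs of points of a fibre -/

section ExponentialMap

universe u

variable {E : Type u} [NormedAddCommGroup E] [NormedSpace ℝ E] [FiniteDimensional ℝ E]
  {B : Type*} [NormedAddCommGroup B] [NormedSpace ℝ B]
  {F : Type*} [NormedAddCommGroup F] [NormedSpace ℝ F]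
  {Q : Type*} [TopologicalSpace Q] [ChartedSpace E Q] [IsManifold 𝓘(ℝ, E) ∞ Q] [T2Space Q]
  {M : Type*} [TopologicalSpace M] [ChartedSpace B M] [IsManifold 𝓘(ℝ, B) ∞ M]
  {π : Q → M} {Γ : VelocityField (E := E) Q} {χ : OpenPartialHomeomorph Q (B × F)}

omit [FiniteDimensional ℝ E] [T2Space Q] [IsManifold 𝓘(ℝ, B) ∞ M] in
theorem IsFibreChart.isFibreTrajectory (hχ : IsFibreChart (E := E) π χ)
    (hΓ : IsSODE (B := B) π Γ) {h : ℝ} (hh : 0 < h) {z : ℝ → B × F × F}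
    (hz : IsSolutionOn (acceleration χ Γ) h z) (hzΩ : ∀ t ∈ Set.Icc 0 h, z t ∈ stateDomain χ)
    (hm : ∀ t ∈ Set.Icc 0 h, (z t).1 = (z 0).1) {q : Q} (hq : q ∈ χ.source)
    (hqz : (χ q).1 = (z 0).1) :
    IsFibreTrajectory (B := B) π Γ (π q) h fun t ↦ (ofState (E := E) χ (z t)).proj := by
  have hc := hχ.isIntegralCurve_ofState hΓ hz hzΩ
  refine ⟨fun t ht ↦ ?_, hc.congr (hc.tangentLift_proj hΓ hh)⟩
  refine (hχ.fst_eq_iff _ (hχ.mapsTo_ofState (hzΩ t ht)).1 _ hq).1 ?_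
  have h1 : χ (χ.symm ((z t).1, (z t).2.1)) = ((z t).1, (z t).2.1) := χ.right_inv (hzΩ t ht)
  rw [hqz, ← hm t ht]
  exact congrArg Prod.fst h1

/-- The coordinates `(m, x, x')` of a pair of points of the same fibre, in a fibre chart. -/
def toPair (χ : OpenPartialHomeomorph Q (B × F)) (p : Q × Q) : B × F × F :=
  ((χ p.1).1, (χ p.1).2, (χ p.2).2)

/-- The pair of points of the same fibre with coordinates `(m, x, x')` in a fibre chart. -/
def ofPair (χ : OpenPartialHomeomorph Q (B × F)) (p : B × F × F) : Q × Q :=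
  (χ.symm (p.1, p.2.1), χ.symm (p.1, p.2.2))

/-- The coordinates of the pairs of points of the same fibre in the open set with coordinates in
`V`. -/
def pairDomain (V : Set (B × F)) : Set (B × F × F) :=
  {p | (p.1, p.2.1) ∈ V ∧ (p.1, p.2.2) ∈ V}

omit [FiniteDimensional ℝ E] [IsManifold 𝓘(ℝ, E) ∞ Q] [T2Space Q] [IsManifold 𝓘(ℝ, B) ∞ M] in
theorem IsFibreChart.mapsTo_ofPair (hχ : IsFibreChart (E := E) π χ) {V : Set (B × F)}
    (hV : V ⊆ χ.target) {p : B × F × F} (hp : p ∈ pairDomain V) :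
    ofPair χ p ∈ ((χ.source ∩ χ ⁻¹' V) ×ˢ (χ.source ∩ χ ⁻¹' V)) ∩ fibrePairs π := by
  have h1 : χ (χ.symm (p.1, p.2.1)) = (p.1, p.2.1) := χ.right_inv (hV hp.1)
  have h2 : χ (χ.symm (p.1, p.2.2)) = (p.1, p.2.2) := χ.right_inv (hV hp.2)
  refine ⟨⟨⟨χ.map_target (hV hp.1), ?_⟩, χ.map_target (hV hp.2), ?_⟩,
    (hχ.fst_eq_iff _ (χ.map_target (hV hp.1)) _ (χ.map_target (hV hp.2))).1 ?_⟩
  · exact (congrArg (· ∈ V) h1).mpr hp.1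
  · exact (congrArg (· ∈ V) h2).mpr hp.2
  · rw [h1, h2]

omit [NormedSpace ℝ B] [NormedSpace ℝ F] [ChartedSpace E Q] [FiniteDimensional ℝ E]
  [IsManifold 𝓘(ℝ, E) ∞ Q] [T2Space Q] in
theorem toPair_ofPair {V : Set (B × F)} (hV : V ⊆ χ.target) {p : B × F × F}
    (hp : p ∈ pairDomain V) : toPair χ (ofPair χ p) = p := by
  have h1 : χ (χ.symm (p.1, p.2.1)) = (p.1, p.2.1) := χ.right_inv (hV hp.1)
  have h2 : χ (χ.symm (p.1, p.2.2)) = (p.1, p.2.2) := χ.right_inv (hV hp.2)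
  simp only [toPair, ofPair, h1, h2]

omit [FiniteDimensional ℝ E] [IsManifold 𝓘(ℝ, E) ∞ Q] [T2Space Q] [IsManifold 𝓘(ℝ, B) ∞ M] in
theorem IsFibreChart.toPair_mem (hχ : IsFibreChart (E := E) π χ) {V : Set (B × F)} {p : Q × Q}
    (hp : p ∈ ((χ.source ∩ χ ⁻¹' V) ×ˢ (χ.source ∩ χ ⁻¹' V)) ∩ fibrePairs π) :
    toPair χ p ∈ pairDomain V ∧ ofPair χ (toPair χ p) = p := by
  obtain ⟨⟨⟨h1, h1V⟩, h2, h2V⟩, hf⟩ := hp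
  have h3 : (χ p.1).1 = (χ p.2).1 := (hχ.fst_eq_iff _ h1 _ h2).2 hf
  have h4 : ((χ p.1).1, (χ p.2).2) = χ p.2 := Prod.ext h3 rfl
  refine ⟨⟨h1V, ?_⟩, Prod.ext (χ.left_inv h1) ?_⟩
  · exact (congrArg (· ∈ V) h4).mpr h2V
  · exact (congrArg χ.symm h4).trans (χ.left_inv h2)

omit [FiniteDimensional ℝ E] [IsManifold 𝓘(ℝ, E) ∞ Q] [T2Space Q] [IsManifold 𝓘(ℝ, B) ∞ M] in
theorem IsFibreChart.contMDiffOn_ofPair (hχ : IsFibreChart (E := E) π χ) {V : Set (B × F)}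
    (hV : V ⊆ χ.target) :
    ContMDiffOn 𝓘(ℝ, B × F × F) (𝓘(ℝ, E).prod 𝓘(ℝ, E)) ∞ (ofPair χ) (pairDomain V) := by
  have h1 : ContMDiff 𝓘(ℝ, B × F × F) 𝓘(ℝ, B × F) ∞ fun p : B × F × F ↦ (p.1, p.2.1) :=
    ContDiff.contMDiff (by fun_prop)
  have h2 : ContMDiff 𝓘(ℝ, B × F × F) 𝓘(ℝ, B × F) ∞ fun p : B × F × F ↦ (p.1, p.2.2) :=
    ContDiff.contMDiff (by fun_prop)
  exact (hχ.contMDiffOn_symm.comp h1.contMDiffOn fun p hp ↦ hV hp.1).prodMk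
    (hχ.contMDiffOn_symm.comp h2.contMDiffOn fun p hp ↦ hV hp.2)

omit [FiniteDimensional ℝ E] [IsManifold 𝓘(ℝ, E) ∞ Q] [T2Space Q] [IsManifold 𝓘(ℝ, B) ∞ M] in
theorem IsFibreChart.contMDiffOn_toPair (hχ : IsFibreChart (E := E) π χ) :
    ContMDiffOn (𝓘(ℝ, E).prod 𝓘(ℝ, E)) 𝓘(ℝ, B × F × F) ∞ (toPair χ)
      (χ.source ×ˢ χ.source) := by
  have h1 := hχ.contMDiffOn.comp
    (contMDiff_fst (I := 𝓘(ℝ, E)) (J := 𝓘(ℝ, E)) (M := Q) (N := Q)).contMDiffOn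
    (s := χ.source ×ˢ χ.source) fun p hp ↦ hp.1
  have h2 := hχ.contMDiffOn.comp
    (contMDiff_snd (I := 𝓘(ℝ, E)) (J := 𝓘(ℝ, E)) (M := Q) (N := Q)).contMDiffOn
    (s := χ.source ×ˢ χ.source) fun p hp ↦ hp.2
  exact (contDiff_fst.contMDiff.comp_contMDiffOn h1).prodMk_space
    ((contDiff_snd.contMDiff.comp_contMDiffOn h1).prodMk_space
      (contDiff_snd.contMDiff.comp_contMDiffOn h2))

end ExponentialMap

end FibredSODE

/-! ### Short trajectories and the exponential map -/

theorem theorem3p1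
    {E : Type*} [NormedAddCommGroup E] [NormedSpace ℝ E] [FiniteDimensional ℝ E]
    {B : Type*} [NormedAddCommGroup B] [NormedSpace ℝ B] [FiniteDimensional ℝ B]
    {Q : Type*} [TopologicalSpace Q] [ChartedSpace E Q] [IsManifold 𝓘(ℝ, E) ∞ Q] [T2Space Q]
    {M : Type*} [TopologicalSpace M] [ChartedSpace B M] [IsManifold 𝓘(ℝ, B) ∞ M] [T2Space M]
    (π : Q → M) (hπ : Manifold.IsSubmersion 𝓘(ℝ, E) 𝓘(ℝ, B) ∞ π)
    (hsurj : Function.Surjective π)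
    (Γ : VelocityField (E := E) Q) (hΓ : IsSODE (B := B) π Γ) (q₀ : Q) :
    -- a compact neighbourhood `K` of the zero vector at `q₀` in `Vπ`, used to single out `v h`
    ∃ K ⊆ verticalBundle (E := E) (B := B) π, IsCompact K ∧
      K ∈ 𝓝[verticalBundle (E := E) (B := B) π] (⟨q₀, 0⟩ : TangentBundle 𝓘(ℝ, E) Q) ∧
    ∃ h₀ > (0 : ℝ), ∀ h : ℝ, 0 < h → h ≤ h₀ →
      ∃ σ₀ : ℝ → Q,
        -- `σ₀` is the trajectory from `q₀` to `q₀` with velocities in `K`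
        IsUniqueOn h (fun σ ↦ IsFibreTrajectory (B := B) π Γ (π q₀) h σ ∧
          σ 0 = q₀ ∧ σ h = q₀ ∧ ∀ t ∈ Set.Icc 0 h, tangentLift (E := E) h σ t ∈ K) σ₀ ∧
        ∃ (𝒰 : Set (TangentBundle 𝓘(ℝ, E) Q)) (U : Set Q),
          -- `𝒰` is an open subset of `Vπ`
          (∃ O : Set (TangentBundle 𝓘(ℝ, E) Q), IsOpen O ∧
            𝒰 = O ∩ verticalBundle (E := E) (B := B) π) ∧
          tangentLift (E := E) h σ₀ 0 ∈ 𝒰 ∧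
          IsOpen U ∧ q₀ ∈ U ∧
          𝒰 ⊆ flowDomain (B := B) π Γ h ∧
          IsDiffeoOn (𝓘(ℝ, E)).tangent (𝓘(ℝ, E).prod 𝓘(ℝ, E)) (expMap (B := B) π Γ h)
            𝒰 ((U ×ˢ U) ∩ fibrePairs π) ∧
          ∀ q q' : Q, (q, q') ∈ (U ×ˢ U) ∩ fibrePairs π →
            ∃ σ : ℝ → Q, IsUniqueOn h (fun σ ↦ IsFibreTrajectory (B := B) π Γ (π q) h σ ∧
              σ 0 = q ∧ σ h = q' ∧ tangentLift (E := E) h σ 0 ∈ 𝒰) σ := by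
  obtain ⟨F, _, _, _, χ, hχ, hq₀⟩ := exists_isFibreChart hπ q₀
  set a₀ : TangentBundle 𝓘(ℝ, E) Q := ⟨q₀, 0⟩
  have ha₀W : a₀ ∈ vectorDomain E χ := hq₀
  set z₀ : B × F × F := toState χ a₀ with hz₀
  have hz₀v : z₀ = ((χ q₀).1, (χ q₀).2, 0) := Prod.ext rfl (Prod.ext rfl
    (congrArg Prod.snd (map_zero (mfderiv 𝓘(ℝ, E) 𝓘(ℝ, B × F) χ q₀ : E →L[ℝ] B × F)) :))
  obtain ⟨R, f, L, C, hR, hRΩ, hf, hff, hL, hC0, hC⟩ := exists_contDiff_eqOn_closedBall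
    (isOpen_stateDomain (χ := χ)) (hχ.contDiffOn_acceleration hΓ) (toState_mem_stateDomain ha₀W)
  rw [← hz₀] at hRΩ hff
  have hcontW : ContinuousOn (toState χ) (vectorDomain E χ) :=
    hχ.contMDiffOn_toState.continuousOn
  refine ⟨ofState χ '' Metric.closedBall z₀ R, ?_, ?_, ?_, ?_⟩
  · rintro _ ⟨z, hz, rfl⟩
    exact (hχ.mapsTo_ofState (hRΩ hz)).2
  · exact (isCompact_closedBall z₀ R).image_of_continuousOn
      (hχ.contMDiffOn_ofState.continuousOn.mono hRΩ)
  · have hO : vectorDomain E χ ∩ toState χ ⁻¹' Metric.ball z₀ R ∈ 𝓝 a₀ :=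
      (hcontW.isOpen_inter_preimage isOpen_vectorDomain Metric.isOpen_ball).mem_nhds
        ⟨ha₀W, Metric.mem_ball_self hR⟩
    filter_upwards [mem_nhdsWithin_of_mem_nhds hO, self_mem_nhdsWithin] with a ha hav
    exact ⟨toState χ a, Metric.ball_subset_closedBall ha.2, hχ.ofState_toState ha.1 hav⟩
  -- The bounds on `h`: the fixed point equations are contractions if `h ≤ 1` and
  -- `2 * L * h < 1`, and the solutions from `q₀` to `q₀` stay in the ball of radius
  -- `R` if `2 * h * C < R`.
  refine ⟨min 1 (min (1 / (4 * (L + 1))) (R / (4 * (C + 1)))), by positivity, fun h hlt hle ↦ ?_⟩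
  have h1 : h ≤ 1 := hle.trans (min_le_left _ _)
  have hLh : 2 * L * h < 1 := by
    have h2 := hle.trans ((min_le_right _ _).trans (min_le_left _ _))
    rw [le_div_iff₀ (by positivity)] at h2
    nlinarith [L.coe_nonneg]
  have hCh : 2 * h * C < R := by
    have h2 := hle.trans ((min_le_right _ _).trans (min_le_right _ _))
    rw [le_div_iff₀ (by positivity)] at h2
    nlinarith
  obtain ⟨Φ, e, b, hΦ, he, hb, hbe, heb, hΦs, hes, hcenter⟩ :=
    exists_boundary_diffeo f hf hL hC hlt h1 hLh
  have h0I : (0 : ℝ) ∈ Set.Icc 0 h := ⟨le_rfl, hlt.le⟩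
  have hhI : h ∈ Set.Icc 0 h := ⟨hlt.le, le_rfl⟩
  -- The initial states whose solution stays in the ball on which `f` is the acceleration of `Γ`.
  let N : Set (B × F × F) := {z | Set.MapsTo (Φ z) Set.univ (Metric.ball z₀ R)}
  have hN : IsOpen N :=
    (ContinuousMap.isOpen_setOfPred_mapsTo isCompact_univ Metric.isOpen_ball).preimage hΦ
  let z : B × F × F → ℝ → B × F × F := fun y ↦ Set.IccExtend hlt.le (Φ y)
  have hzf : ∀ y, IsSolutionOn f h (z y) := fun y ↦ (hΦs y).1
  have hz0 : ∀ y, z y 0 = y := fun y ↦ (hΦs y).2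
  have hzball : ∀ y ∈ N, ∀ t, z y t ∈ Metric.ball z₀ R := fun y hy t ↦ hy (Set.mem_univ _)
  have hzΩ : ∀ y ∈ N, ∀ t ∈ Set.Icc 0 h, z y t ∈ stateDomain χ := fun y hy t _ ↦
    hRΩ (Metric.ball_subset_closedBall (hzball y hy t))
  have hNΩ : N ⊆ stateDomain χ := fun y hy ↦ by
    have := hzΩ y hy 0 h0I
    rwa [hz0] at this
  have hzs : ∀ y ∈ N, IsSolutionOn (acceleration χ Γ) h (z y) := fun y hy t ht ↦ by
    rw [← hff (Metric.ball_subset_closedBall (hzball y hy t))]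
    exact hzf y t ht
  have hzm : ∀ y, ∀ t ∈ Set.Icc 0 h, (z y t).1 = (z y 0).1 := fun y t ht ↦
    (hzf y).fst_eq hlt ht
  let c : B × F × F → ℝ → TangentBundle 𝓘(ℝ, E) Q := fun y ↦ ofState χ ∘ z y
  have hc : ∀ y ∈ N, IsIntegralCurve (B := B) π Γ h (c y) := fun y hy ↦
    hχ.isIntegralCurve_ofState hΓ (hzs y hy) (hzΩ y hy)
  have hc0 : ∀ y, c y 0 = ofState χ y := fun y ↦ congrArg (ofState χ) (hz0 y)
  have hlift : ∀ y ∈ N, Set.EqOn (tangentLift (E := E) h fun t ↦ (c y t).proj) (c y)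
      (Set.Icc 0 h) := fun y hy ↦ (hc y hy).tangentLift_proj hΓ hlt
  have hexp : ∀ y ∈ N, expMap (B := B) π Γ h (ofState (E := E) χ y) = ofPair χ (e y) :=
    fun y hy ↦ by
      have h2 := (hc y hy).flow_eq hπ hΓ hlt.le
      rw [hc0] at h2
      have h3 := hes _ (hzf y)
      rw [hz0] at h3
      rw [expMap, h2, h3, ofPair]
      have h4 : (c y h).proj = χ.symm ((z y h).1, (z y h).2.1) := rfl
      rw [h4, hzm y h hhI, hz0]
      rfl
  -- The initial state of the trajectory that returns to `q₀` at time `h`.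
  let y₀ : B × F × F := b ((χ q₀).1, (χ q₀).2, (χ q₀).2)
  have hy₀ : y₀ ∈ N := fun t _ ↦ by
    have := (hcenter (χ q₀).1 (χ q₀).2 t).trans_lt hCh
    rwa [← hz₀v, ← dist_eq_norm] at this
  -- A ball `V` around `χ q₀` such that all boundary data with end points in `V` have their solution
  -- in the ball of radius `R`; the norm of a product is the maximum of the norms.
  obtain ⟨V, hVo, hVq, hVt, hVN⟩ : ∃ V : Set (B × F), IsOpen V ∧ χ q₀ ∈ V ∧ V ⊆ χ.target ∧
      ∀ p ∈ pairDomain V, b p ∈ N := by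
    obtain ⟨r, hr, hrN⟩ := Metric.isOpen_iff.1 (hN.preimage hb.continuous)
      ((χ q₀).1, (χ q₀).2, (χ q₀).2) hy₀
    refine ⟨Metric.ball (χ q₀) r ∩ χ.target, Metric.isOpen_ball.inter χ.open_target,
      ⟨Metric.mem_ball_self hr, χ.map_source hq₀⟩, Set.inter_subset_right, fun p hp ↦ hrN ?_⟩
    have h2 := Metric.mem_ball.1 hp.1.1
    have h3 := Metric.mem_ball.1 hp.2.1
    rw [Prod.dist_eq, max_lt_iff] at h2 h3
    rw [Metric.mem_ball, Prod.dist_eq, Prod.dist_eq]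
    exact max_lt h2.1 (max_lt h2.2 h3.2)
  have hpV : IsOpen (pairDomain V) :=
    (hVo.preimage (by fun_prop : Continuous fun p : B × F × F ↦ (p.1, p.2.1))).inter
      (hVo.preimage (by fun_prop : Continuous fun p : B × F × F ↦ (p.1, p.2.2)))
  let O : Set (TangentBundle 𝓘(ℝ, E) Q) :=
    vectorDomain E χ ∩ toState χ ⁻¹' (N ∩ e ⁻¹' pairDomain V)
  have hO : IsOpen O :=
    hcontW.isOpen_inter_preimage isOpen_vectorDomain (hN.inter (hpV.preimage he.continuous))
  let 𝒰 : Set (TangentBundle 𝓘(ℝ, E) Q) := O ∩ verticalBundle (E := E) (B := B) π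
  let U : Set Q := χ.source ∩ χ ⁻¹' V
  have hU : IsOpen U := χ.isOpen_inter_preimage hVo
  have h𝒰b : ∀ p ∈ pairDomain V, ofState χ (b p) ∈ 𝒰 := fun p hp ↦ by
    obtain ⟨h2, h3⟩ := hχ.mapsTo_ofState (hNΩ (hVN p hp))
    refine ⟨⟨h2, ?_⟩, h3⟩
    rw [Set.mem_preimage, hχ.toState_ofState (hNΩ (hVN p hp))]
    refine ⟨hVN p hp, ?_⟩
    rwa [Set.mem_preimage, heb]
  have h𝒰 : ∀ a ∈ 𝒰, toState χ a ∈ N ∧ e (toState χ a) ∈ pairDomain V ∧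
      ofState χ (toState χ a) = a := fun a ha ↦
    ⟨ha.1.2.1, ha.1.2.2, hχ.ofState_toState ha.1.1 ha.2⟩
  have hexp𝒰 : ∀ a ∈ 𝒰, expMap (B := B) π Γ h a = ofPair χ (e (toState χ a)) := fun a ha ↦ by
    obtain ⟨h2, -, h3⟩ := h𝒰 a ha
    conv_lhs => rw [← h3]
    exact hexp _ h2
  -- The inverse of the exponential map solves the boundary value problem.
  let g : Q × Q → TangentBundle 𝓘(ℝ, E) Q := fun p ↦ ofState χ (b (toPair χ p))
  have hinv : Set.InvOn g (expMap (B := B) π Γ h) 𝒰 ((U ×ˢ U) ∩ fibrePairs π) := by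
    refine ⟨fun a ha ↦ ?_, fun p hp ↦ ?_⟩
    · obtain ⟨-, h2, h3⟩ := h𝒰 a ha
      simp only [g]
      rw [hexp𝒰 a ha, toPair_ofPair hVt h2, hbe, h3]
    · obtain ⟨h2, h3⟩ := hχ.toPair_mem hp
      simp only [g]
      rw [hexp _ (hVN _ h2), heb, h3]
  have hmaps : Set.MapsTo (expMap (B := B) π Γ h) 𝒰 ((U ×ˢ U) ∩ fibrePairs π) := fun a ha ↦ by
    rw [hexp𝒰 a ha]
    exact hχ.mapsTo_ofPair hVt (h𝒰 a ha).2.1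
  have hmaps' : Set.MapsTo g ((U ×ˢ U) ∩ fibrePairs π) 𝒰 := fun p hp ↦
    h𝒰b _ (hχ.toPair_mem hp).1
  have hq₀V : ((χ q₀).1, (χ q₀).2, (χ q₀).2) ∈ pairDomain V := ⟨hVq, hVq⟩
  have hmemq₀ : (q₀, q₀) ∈ (U ×ˢ U) ∩ fibrePairs π := ⟨⟨⟨hq₀, hVq⟩, hq₀, hVq⟩, rfl⟩
  -- The trajectory between two given nearby points of a fibre.
  have hends : ∀ p ∈ (U ×ˢ U) ∩ fibrePairs π, (c (b (toPair χ p)) 0).proj = p.1 ∧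
      (c (b (toPair χ p)) h).proj = p.2 := fun p hp ↦ by
    have hy := hVN _ (hχ.toPair_mem hp).1
    have h2 := (hc _ hy).flow_eq hπ hΓ hlt.le
    have h3 : expMap (B := B) π Γ h (ofState χ (b (toPair χ p))) = p := hinv.2 hp
    rw [hc0] at h2
    rw [expMap, h2] at h3
    rw [hc0]
    exact ⟨congrArg Prod.fst h3, congrArg Prod.snd h3⟩
  have htraj : ∀ p ∈ (U ×ˢ U) ∩ fibrePairs π, IsFibreTrajectory (B := B) π Γ (π p.1) h
      fun t ↦ (c (b (toPair χ p)) t).proj := fun p hp ↦ by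
    have hy := hVN _ (hχ.toPair_mem hp).1
    refine hχ.isFibreTrajectory hΓ hlt (hzs _ hy) (hzΩ _ hy) (hzm _) hp.1.1.1 ?_
    have h2 := hes _ (hzf (b (toPair χ p)))
    rw [hz0, heb] at h2
    rw [hz0]
    exact (congrArg Prod.fst h2 :)
  have huniq : ∀ y ∈ N, ∀ σ : ℝ → Q, IsIntegralCurve (B := B) π Γ h (tangentLift (E := E) h σ) →
      tangentLift (E := E) h σ 0 = ofState χ y →
      Set.EqOn σ (fun t ↦ (c y t).proj) (Set.Icc 0 h) := fun y hy σ hσ hσ0 t ht ↦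
    congrArg Bundle.TotalSpace.proj
      ((hc y hy).eqOn hπ hΓ hσ (hσ0.trans (hc0 y).symm) ht)
  have hlift0 : ∀ p ∈ (U ×ˢ U) ∩ fibrePairs π,
      tangentLift (E := E) h (fun t ↦ (c (b (toPair χ p)) t).proj) 0 ∈ 𝒰 := fun p hp ↦ by
    rw [hlift _ (hVN _ (hχ.toPair_mem hp).1) h0I, hc0]
    exact h𝒰b _ (hχ.toPair_mem hp).1
  refine ⟨fun t ↦ (c y₀ t).proj, ⟨⟨htraj _ hmemq₀, (hends _ hmemq₀).1, (hends _ hmemq₀).2,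
    fun t ht ↦ ?_⟩, ?_⟩, 𝒰, U, ⟨O, hO, rfl⟩, hlift0 _ hmemq₀, hU,
    ⟨hq₀, hVq⟩, fun a ha ↦ ?_, ⟨hinv.bijOn hmaps hmaps', ?_, g, hinv, ?_⟩, fun q q' hqq' ↦ ?_⟩
  · rw [hlift y₀ hy₀ ht]
    exact ⟨z y₀ t, Metric.ball_subset_closedBall (hzball y₀ hy₀ t), rfl⟩
  · rintro σ ⟨⟨-, hσ⟩, hσ0, hσh, hσK⟩
    have hK : ∀ t ∈ Set.Icc 0 h, tangentLift (E := E) h σ t ∈ vectorDomain E χ ∧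
        toState χ (tangentLift (E := E) h σ t) ∈ Metric.closedBall z₀ R := fun t ht ↦ by
      obtain ⟨y, hy, hyt⟩ := hσK t ht
      rw [← hyt, hχ.toState_ofState (hRΩ hy)]
      exact ⟨(hχ.mapsTo_ofState (hRΩ hy)).1, hy⟩
    -- Velocities in `K` make `σ` a solution of the equation with the cut-off acceleration, whose
    -- boundary value problem has only one solution.
    have hsol : IsSolutionOn f h (toState χ ∘ tangentLift (E := E) h σ) := fun t ht ↦ by
      have h2 := hχ.hasDerivWithinAt_toState hΓ hσ ht (hK t ht).1
      rw [← hff (hK t ht).2] at h2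
      exact h2
    have h2 : e (toState χ (tangentLift (E := E) h σ 0)) = 
        ((χ (σ 0)).1, (χ (σ 0)).2, (χ (σ h)).2) :=
      hes _ hsol
    rw [hσ0, hσh] at h2
    have h3 : toState χ (tangentLift (E := E) h σ 0) = y₀ := by
      rw [← hbe (toState χ (tangentLift (E := E) h σ 0)), h2]
    refine huniq y₀ hy₀ σ hσ ?_
    rw [← h3, hχ.ofState_toState (hK 0 h0I).1 (hσ.1 0 h0I)]
  · obtain ⟨h2, -, h3⟩ := h𝒰 a ha
    exact ⟨c (toState χ a), (hc0 _).trans h3, hc _ h2⟩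
  · have h2 : ContMDiffOn (𝓘(ℝ, E)).tangent 𝓘(ℝ, B × F × F) ∞ (fun a ↦ e (toState χ a)) 𝒰 :=
      he.contMDiff.comp_contMDiffOn (hχ.contMDiffOn_toState.mono fun a ha ↦ ha.1.1)
    exact ((hχ.contMDiffOn_ofPair hVt).comp h2 fun a ha ↦ (h𝒰 a ha).2.1).congr hexp𝒰
  · have h2 : ContMDiffOn (𝓘(ℝ, E).prod 𝓘(ℝ, E)) 𝓘(ℝ, B × F × F) ∞ (fun p ↦ b (toPair χ p))
        ((U ×ˢ U) ∩ fibrePairs π) :=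
      hb.contMDiff.comp_contMDiffOn (hχ.contMDiffOn_toPair.mono fun p hp ↦
        ⟨hp.1.1.1, hp.1.2.1⟩)
    exact hχ.contMDiffOn_ofState.comp h2 fun p hp ↦ hNΩ (hVN _ (hχ.toPair_mem hp).1)
  · refine ⟨fun t ↦ (c (b (toPair χ (q, q'))) t).proj, ⟨htraj _ hqq', (hends _ hqq').1,
      (hends _ hqq').2, hlift0 _ hqq'⟩, ?_⟩
    rintro σ ⟨⟨-, hσ⟩, hσ0, hσh, hσ𝒰⟩
    refine huniq _ (hVN _ (hχ.toPair_mem hqq').1) σ hσ ?_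
    have h2 : expMap (B := B) π Γ h (tangentLift (E := E) h σ 0) = (q, q') := by
      rw [expMap, hσ.flow_eq hπ hΓ hlt.le]
      exact Prod.ext hσ0 hσh
    rw [← hinv.1 hσ𝒰, h2]
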